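/- Let $\mathbb S=\{i\in\mathbb H:\operatorname{Re} i=0,\ |i|=1\}$ and $\mathbb C_i=\mathbb R+i\mathbb R$ for $i\in\mathbb S$. Let $V_R$ be a quaternionic right Banach space: a complete real normed space with a right multiplication by quaternions that extends the real one and satisfies $\|va\|=\|v\||a|$. Let $T$ be a closed right linear operator on $V_R$ with domain $\mathcal D(T)\subseteq V_R$. For $s\in\mathbb H$ put $\mathcal Q_s(T)=T^2-2\operatorname{Re}(s)T+|s|^2\mathcal I$ on $\mathcal D(T^2)$; let $\rho_S(T)$ be the set of those $s$ for which $\mathcal Q_s(T)$ has an everywhere defined bounded inverse, let $\sigma_S(T)=\mathbb H\setminus\rho_S(T)$, and assume $\rho_S(T)\neq\emptyset$. For $s\in\rho_S(T)$ and $v\in V_R$ put $\mathcal R_s(T;v)=(\mathcal Q_s(T)^{-1}v)\overline s-T\mathcal Q_s(T)^{-1}v$. "$T$ is bounded" means that $T$ is everywhere defined and bounded. Let $f$ be intrinsic slice hyperholomorphic on an open axially symmetric set $\mathcal D(f)\supseteq\sigma_S(T)$, that is, $f(x_0+ix_1)=\alpha(x_0,x_1)+i\beta(x_0,x_1)$ for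 all $i\in\mathbb S$, $x_0,x_1\in\mathbb R$ with $x_0+ix_1\in\mathcal D(f)$, where $\alpha,\beta$ are real valued and differentiable, $\alpha$ is even and $\beta$ is odd in $x_1$, and they satisfy the Cauchy-Riemann equations. If $T$ is unbounded, assume also that $\mathcal D(f)$ contains a neighbourhood of infinity and that $f(\infty)=\lim_{x\to\infty}f(x)$ exists. A Cauchy domain in a complex plane is an open set with finitely many components whose closures are pairwise disjoint, and whose boundary consists of a finite positive number of closed piecewise continuously differentiable Jordan curves; the boundary is oriented positively, which means that it has total winding number $1$ around the points of the set and $0$ around the points outside of its closure if the set is bounded, and $0$ resp. $-1$ if the set is unbounded. A slice Cauchy domain is an open axially symmetric $U\subseteq\mathbb H$ such that $U\cap\mathbb C_i$ is a Cauchy domain for every $i\in\mathbb S$. Call $U$ admissible if it is a slice Cauchy domain with $\sigma_S(T)\subset U$ and $\overline U\subset\mathcal D(f)$ and if either (a) $U$ is unbounded, $\mathcal D(f)$ contains a neighbourhood of infinity and $c_U:=f(\infty)$ exists, or (b) $T$ is bounded and $U$ is bounded, in which case $c_U:=0$ (this amounts to extending $f$ by $0$ to a neighbourhood of infinity). Suppose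 that $V_R$ also carries a left multiplication by quaternions that turns it into a two-sided quaternionic Banach space $V$ (it agrees with the right one for real scalars, and $\|av\|=|a|\|v\|$). The $S$-functional calculus on $V$ defines, with $ds_i=-i\,ds$, $$f(T)=c_U\mathcal I+\frac1{2\pi}\int_{\partial(U\cap\mathbb C_i)}S_L^{-1}(s,T)\,ds_i\,f(s)\qquad\text{or}\qquad f(T)=c_U\mathcal I+\frac1{2\pi}\int_{\partial(U\cap\mathbb C_i)}f(s)\,ds_i\,S_R^{-1}(s,T)$$ for some admissible $U$ and some $i\in\mathbb S$, where $S_L^{-1}(s,T)=\mathcal Q_s(T)^{-1}\overline s-T\mathcal Q_s(T)^{-1}$, $S_R^{-1}(s,T)=-(T-\mathcal I\overline s)\mathcal Q_s(T)^{-1}$, and $(aA)v=a(Av)$, $(Aa)v=A(av)$ for bounded operators $A$ and $a\in\mathbb H$; the integrals are taken in the bounded real linear operators. Theorem. (1) Let $f(T)$ be obtained in either of these ways from any choice of $U$ and $i$. Then for every $i\in\mathbb S$, every admissible $U$ and every $v\in V$ the following integrand is integrable along the boundary and $$f(T)v=v\,c_U+\int_{\partial(U\cap\mathbb C_i)}\mathcal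 R_z(T;v)\,f(z)\,dz\,\frac{-i}{2\pi}.$$ The right-hand side only uses the right scalar multiplication. (2) If $V_R$ is turned into two-sided quaternionic Banach spaces $V_1$ and $V_2$ by two left multiplications, then the operators $[f(T)]_1$ and $[f(T)]_2$ obtained from the $S$-functional calculus on $V_1$ and $V_2$ coincide. (3) Let $i\in\mathbb S$, let $V_i$ be $V$ as a complex Banach space over $\mathbb C_i$ with the scalars acting from the right, and let $f_i=f|_{\mathcal D(f)\cap\mathbb C_i}$. Whenever $f(T)$ is obtained from the $S$-functional calculus, the Riesz-Dunford functional calculus of the closed $\mathbb C_i$-linear operator $T$ on $V_i$ applies to $f_i$, and it yields the same operator, for every Cauchy domain over which it can be computed: the domain $W\subset\mathbb C_i$ contains the spectrum of $T$ on $V_i$ and has its closure in $\mathcal D(f)\cap\mathbb C_i$; it is either unbounded, $\mathcal D(f)\cap\mathbb C_i$ contains a neighbourhood of infinity in $\mathbb C_i$ and the term $f_i(\infty)\mathcal I$ is added to the integral, or $W$ is bounded, $T$ is bounded and no term is added. -/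

import Mathlib

open Set Filter Topology Quaternion RightActions

noncomputable section

/-! ### Imaginary units, complex planes and axial symmetry -/

/-- The sphere of normalized purely imaginary quaternions. -/
def ImagUnit : Type := {q : ℍ // q.re = 0 ∧ ‖q‖ = 1}

theorem ImagUnit.mul_self (i : ImagUnit) : (i.1 * i.1 : ℍ) = -1 := by
  have hs : star i.1 = -i.1 := (QuaternionAlgebra.star_eq_neg).2 i.2.1
  have h := Quaternion.self_mul_star i.1
  rw [hs, Quaternion.normSq_eq_norm_mul_self, i.2.2] at h
  have h2 : -(i.1 * i.1) = (1 : ℍ) := by simpa using h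
  rw [← h2, neg_neg]

/-- The embedding `x₀ + √-1 x₁ ↦ x₀ + i x₁` of `ℂ` into `ℍ`; its range is the plane `ℂ_i`. -/
def planeHom (i : ImagUnit) : ℂ →ₐ[ℝ] ℍ := Complex.lift ⟨i.1, i.mul_self⟩

theorem planeHom_apply (i : ImagUnit) (z : ℂ) :
    planeHom i z = (z.re : ℍ) + i.1 * (z.im : ℍ) := by
  have h : planeHom i z = (z.re : ℍ) + z.im • i.1 := rfl
  rw [h, Quaternion.mul_coe_eq_smul]

theorem norm_planeHom (i : ImagUnit) (z : ℂ) : ‖planeHom i z‖ = ‖z‖ := by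
  have hr : (planeHom i z).re = z.re := by
    rw [planeHom_apply, Quaternion.mul_coe_eq_smul]; simp [i.2.1]
  have h1 : Quaternion.normSq i.1 = 1 := by
    rw [Quaternion.normSq_eq_norm_mul_self, i.2.2]; norm_num
  have h2 : Quaternion.normSq (planeHom i z) = Complex.normSq z := by
    rw [planeHom_apply, Quaternion.mul_coe_eq_smul]
    rw [Quaternion.normSq_def'] at h1 ⊢
    have h0 := i.2.1
    simp [h0] at h1 ⊢
    rw [Complex.normSq_apply]
    linear_combination z.im ^ 2 * h1
  rw [Quaternion.normSq_eq_norm_mul_self, Complex.normSq_eq_norm_sq] at h2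
  nlinarith [norm_nonneg z, norm_nonneg (planeHom i z),
    sq_nonneg (‖planeHom i z‖ - ‖z‖), sq_nonneg (‖planeHom i z‖ + ‖z‖)]

/-- The coordinate in `ℂ` of the `ℂ_i`-part of a quaternion; on `ℂ_i` it inverts `planeHom i`. -/
def planeCoord (i : ImagUnit) (q : ℍ) : ℂ := ⟨q.re, -(q * i.1).re⟩

theorem planeCoord_planeHom (i : ImagUnit) (z : ℂ) : planeCoord i (planeHom i z) = z := by
  have h0 := i.2.1
  have h1 : Quaternion.normSq i.1 = 1 := by
    rw [Quaternion.normSq_eq_norm_mul_self, i.2.2]; norm_num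
  rw [Quaternion.normSq_def'] at h1
  have hz := planeHom_apply i z
  rw [Quaternion.mul_coe_eq_smul] at hz
  apply Complex.ext
  · change (planeHom i z).re = z.re
    rw [hz]; simp [h0]
  · change -(planeHom i z * i.1).re = z.im
    rw [hz]
    simp [h0] at h1 ⊢
    linear_combination z.im * h1

/-- The intersection `U ∩ ℂ_i`, seen as a subset of `ℂ`. -/
def slice (i : ImagUnit) (U : Set ℍ) : Set ℂ := planeHom i ⁻¹' U

/-- The sphere `[x] = {x₀ + i x₁ : i imaginary unit}`, where `x₁` is the modulus of the imaginary
part of `x`. -/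
def sphereOf (x : ℍ) : Set ℍ := {y | ∃ i : ImagUnit, y = (x.re : ℍ) + i.1 * (‖x.im‖ : ℍ)}

def IsAxiallySymmetric (U : Set ℍ) : Prop := ∀ x ∈ U, sphereOf x ⊆ U

/-! ### Intrinsic slice hyperholomorphic functions -/

/-- `f` is an intrinsic slice hyperholomorphic function with domain `D`: it is of the form
`f (x₀ + i x₁) = α (x₀, x₁) + i β (x₀, x₁)` with real valued `α` and `β` that satisfy the
compatibility condition and the Cauchy-Riemann equations. -/
structure IsIntrinsicSliceHyperholomorphic (f : ℍ → ℍ) (D : Set ℍ) : Prop where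
  isOpen : IsOpen D
  axiallySymmetric : IsAxiallySymmetric D
  exists_components : ∃ α β : ℝ × ℝ → ℝ,
    ∀ (i : ImagUnit) (x₀ x₁ : ℝ), (x₀ : ℍ) + i.1 * (x₁ : ℍ) ∈ D →
      f ((x₀ : ℍ) + i.1 * (x₁ : ℍ)) = (α (x₀, x₁) : ℍ) + i.1 * (β (x₀, x₁) : ℍ) ∧
      α (x₀, x₁) = α (x₀, -x₁) ∧
      β (x₀, x₁) = -β (x₀, -x₁) ∧
      DifferentiableAt ℝ α (x₀, x₁) ∧
      DifferentiableAt ℝ β (x₀, x₁) ∧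
      fderiv ℝ α (x₀, x₁) (1, 0) = fderiv ℝ β (x₀, x₁) (0, 1) ∧
      fderiv ℝ α (x₀, x₁) (0, 1) = -fderiv ℝ β (x₀, x₁) (1, 0)

/-- For `f` with domain `D` in a normed space: `D` contains a neighbourhood of infinity and
`f(∞) = lim_{x → ∞} f(x)` exists and equals `c`. -/
def HasValueAtInfinity {E : Type*} [NormedAddCommGroup E] (f : E → E) (D : Set E) (c : E) :
    Prop :=
  (∃ r : ℝ, 0 < r ∧ (Metric.ball (0 : E) r)ᶜ ⊆ D) ∧ Tendsto f (Bornology.cobounded E) (𝓝 c)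

/-! ### Cauchy domains -/

/-- `γ`, restricted to `[0,1]`, is a closed piecewise continuously differentiable Jordan curve. -/
def IsPiecewiseC1JordanCurve (γ : ℝ → ℂ) : Prop :=
  ContinuousOn γ (Icc 0 1) ∧ γ 0 = γ 1 ∧ InjOn γ (Ico 0 1) ∧
    ∃ (n : ℕ) (t : Fin (n + 1) → ℝ), StrictMono t ∧ t 0 = 0 ∧ t (Fin.last n) = 1 ∧
      ∀ k : Fin n, ContDiffOn ℝ 1 γ (Icc (t k.castSucc) (t k.succ))

/-- The boundary of `W` consists of the finitely many (and at least one) closed Jordan curves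
`γ l`. -/
def IsBoundaryOf {n : ℕ} (γ : Fin n → ℝ → ℂ) (W : Set ℂ) : Prop :=
  0 < n ∧ (∀ l, IsPiecewiseC1JordanCurve (γ l)) ∧ ⋃ l, γ l '' Icc 0 1 = frontier W

structure IsCauchyDomain (W : Set ℂ) : Prop where
  isOpen : IsOpen W
  finite_components : {C | ∃ z ∈ W, C = connectedComponentIn W z}.Finite
  disjoint_closures : ∀ z ∈ W, ∀ w ∈ W, connectedComponentIn W z ≠ connectedComponentIn W w →
    Disjoint (closure (connectedComponentIn W z)) (closure (connectedComponentIn W w))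
  boundary : ∃ (n : ℕ) (γ : Fin n → ℝ → ℂ), IsBoundaryOf γ W

structure IsSliceCauchyDomain (U : Set ℍ) : Prop where
  isOpen : IsOpen U
  axiallySymmetric : IsAxiallySymmetric U
  slices : ∀ i : ImagUnit, IsCauchyDomain (slice i U)

/-- The integral of the form `F z dz` along a finite family of curves. -/
def curvesIntegral {n : ℕ} {E : Type*} [NormedAddCommGroup E] [NormedSpace ℝ E]
    (γ : Fin n → ℝ → ℂ) (F : ℂ → ℂ → E) : E :=
  ∑ l, ∫ t in (0 : ℝ)..1, F (γ l t) (deriv (γ l) t)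

def CurvesIntegrable {n : ℕ} {E : Type*} [NormedAddCommGroup E] [NormedSpace ℝ E]
    (γ : Fin n → ℝ → ℂ) (F : ℂ → ℂ → E) : Prop :=
  ∀ l, IntervalIntegrable (fun t => F (γ l t) (deriv (γ l) t)) MeasureTheory.volume 0 1

/-- The total winding number of a finite family of closed curves around `z`. -/
def totalIndex {n : ℕ} (γ : Fin n → ℝ → ℂ) (z : ℂ) : ℂ :=
  (2 * Real.pi * Complex.I)⁻¹ * curvesIntegral γ (fun w dw => dw / (w - z))

open Classical in
/-- The curves `γ l` make up the boundary `∂W`, oriented positively with respect to `W`: for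
bounded `W` the total index is `1` in `W` and `0` outside of the closure of `W`; for unbounded `W`
it is `0` in `W` and `-1` outside of the closure of `W`. -/
structure IsPositiveBoundary {n : ℕ} (γ : Fin n → ℝ → ℂ) (W : Set ℂ) : Prop where
  boundary : IsBoundaryOf γ W
  index_inside : ∀ z ∈ W, totalIndex γ z = if Bornology.IsBounded W then 1 else 0
  index_outside : ∀ z ∉ closure W, totalIndex γ z = if Bornology.IsBounded W then 0 else -1

/-! ### Operators with domain -/

section Operators

variable {R E : Type*} [Ring R] [NormedAddCommGroup E] [Module R E]

/-- The operator `T²` with domain `{v ∈ dom T : T v ∈ dom T}`. -/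
def opSq (T : E →ₗ.[R] E) : E →ₗ.[R] E :=
  T.comp (T.domRestrict ((T.domain.comap T.toFun).map T.domain.subtype)) <| by
    rintro ⟨x, hx⟩
    obtain ⟨⟨y, hy, rfl⟩, -⟩ := hx
    exact hy

/-- The identity operator, with the whole space as its domain. -/
def opId (R E : Type*) [Ring R] [NormedAddCommGroup E] [Module R E] : E →ₗ.[R] E :=
  (LinearMap.id : E →ₗ[R] E).toPMap ⊤

/-- The everywhere defined bounded operator `B` is the inverse of `A : dom A → E`. -/
def IsBoundedInverse (A : E →ₗ.[R] E) (B : E →L[R] E) : Prop :=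
  (∀ v : E, ∃ h : B v ∈ A.domain, A ⟨B v, h⟩ = v) ∧ ∀ u : A.domain, B (A u) = u

/-- `T` is an everywhere defined bounded operator. -/
def IsBoundedOperator (T : E →ₗ.[R] E) : Prop :=
  T.domain = ⊤ ∧ ∃ C : ℝ, ∀ u : T.domain, ‖T u‖ ≤ C * ‖(u : E)‖

end Operators

/-! ### The Riesz-Dunford functional calculus on complex Banach spaces -/

section RieszDunford

variable {E : Type*} [NormedAddCommGroup E] [NormedSpace ℂ E]

def complexResolventSet (A : E →ₗ.[ℂ] E) : Set ℂ :=
  {z | ∃ B : E →L[ℂ] E, IsBoundedInverse (z • opId ℂ E - A) B}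

open Classical in
/-- The resolvent `(z - A)⁻¹` for `z` in the resolvent set. -/
def complexResolvent (A : E →ₗ.[ℂ] E) (z : ℂ) : E →L[ℂ] E :=
  if h : ∃ B : E →L[ℂ] E, IsBoundedInverse (z • opId ℂ E - A) B then h.choose else 0

/-- `B = g(A)` in the sense of the Riesz-Dunford functional calculus for the holomorphic function
`g` with domain `D`, that is `B = g(∞) I + (2πi)⁻¹ ∫_{∂W} g(z) (z - A)⁻¹ dz` for an unbounded Cauchy
domain `W`, or, if `A` is bounded, `B = (2πi)⁻¹ ∫_{∂W} g(z) (z - A)⁻¹ dz` for a bounded one. -/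
def IsRieszDunford (A : E →ₗ.[ℂ] E) (g : ℂ → ℂ) (D : Set ℂ) (B : E →L[ℂ] E) : Prop :=
  IsOpen D ∧ DifferentiableOn ℂ g D ∧
  ∃ (W : Set ℂ) (c : ℂ) (n : ℕ) (γ : Fin n → ℝ → ℂ),
    IsCauchyDomain W ∧ (complexResolventSet A)ᶜ ⊆ W ∧ closure W ⊆ D ∧
    ((¬ Bornology.IsBounded W ∧ HasValueAtInfinity g D c) ∨
      (IsBoundedOperator A ∧ Bornology.IsBounded W ∧ c = 0)) ∧
    IsPositiveBoundary γ W ∧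
    B = c • ContinuousLinearMap.id ℂ E + (2 * Real.pi * Complex.I : ℂ)⁻¹ •
      curvesIntegral γ (fun z dz => (g z * dz) • complexResolvent A z)

end RieszDunford

/-! ### Quaternionic right Banach spaces -/

section Quaternionic

variable {V : Type*} [NormedAddCommGroup V] [NormedSpace ℝ V] [CompleteSpace V]
  [Module ℍᵐᵒᵖ V] [IsScalarTower ℝ ℍᵐᵒᵖ V] [NormSMulClass ℍᵐᵒᵖ V]

variable (V) in
/-- Closed right linear operators on `V`, in general with a proper subspace as their domain. -/
structure ClosedRightOperator where
  op : V →ₗ.[ℍᵐᵒᵖ] V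
  closed : IsClosed (op.graph : Set (V × V))

/-- `Q_s(T) = T² - 2 s₀ T + |s|² I` on the domain of `T²`. -/
def quadOp (T : ClosedRightOperator V) (s : ℍ) : V →ₗ.[ℍᵐᵒᵖ] V :=
  opSq T.op - (2 * s.re) • T.op + (‖s‖ ^ 2) • opId ℍᵐᵒᵖ V

def sResolventSet (T : ClosedRightOperator V) : Set ℍ :=
  {s | ∃ B : V →L[ℍᵐᵒᵖ] V, IsBoundedInverse (quadOp T s) B}

def sSpectrum (T : ClosedRightOperator V) : Set ℍ := (sResolventSet T)ᶜ

open Classical in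
/-- The pseudo-resolvent `Q_s(T)⁻¹` for `s` in the S-resolvent set. -/
def pseudoResolvent (T : ClosedRightOperator V) (s : ℍ) : V →L[ℍᵐᵒᵖ] V :=
  if h : ∃ B : V →L[ℍᵐᵒᵖ] V, IsBoundedInverse (quadOp T s) B then h.choose else 0

theorem pseudoResolvent_mem (T : ClosedRightOperator V) (s : ℍ) (v : V) :
    pseudoResolvent T s v ∈ T.op.domain := by
  unfold pseudoResolvent
  split_ifs with h
  · obtain ⟨h1, -⟩ := h.choose_spec.1 v
    exact h1.1.2
  · simp

/-- `T Q_s(T)⁻¹` as a right linear map. -/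
def opPseudoResolventLin (T : ClosedRightOperator V) (s : ℍ) : V →ₗ[ℍᵐᵒᵖ] V :=
  T.op.toFun ∘ₗ (pseudoResolvent T s).toLinearMap.codRestrict T.op.domain
    (pseudoResolvent_mem T s)

theorem opPseudoResolventLin_isClosed_graph (T : ClosedRightOperator V) (s : ℍ) :
    IsClosed (((opPseudoResolventLin T s).restrictScalars ℝ).graph : Set (V × V)) := by
  have h : (((opPseudoResolventLin T s).restrictScalars ℝ).graph : Set (V × V)) =
      (fun p : V × V => (pseudoResolvent T s p.1, p.2)) ⁻¹' (T.op.graph : Set (V × V)) := by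
    ext ⟨v, w⟩
    simp only [SetLike.mem_coe, LinearMap.mem_graph_iff, mem_preimage, LinearPMap.mem_graph_iff]
    constructor
    · intro hw
      exact ⟨⟨_, pseudoResolvent_mem T s v⟩, rfl, hw.symm⟩
    · rintro ⟨⟨y, hy⟩, h1, h2⟩
      change y = _ at h1
      subst h1
      exact h2.symm
  rw [h]
  exact T.closed.preimage (by fun_prop)

/-- The bounded operator `T Q_s(T)⁻¹`. -/
def opPseudoResolvent (T : ClosedRightOperator V) (s : ℍ) : V →L[ℝ] V :=
  ContinuousLinearMap.ofIsClosedGraph (opPseudoResolventLin_isClosed_graph T s)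

/-- `R_s(T; v) = Q_s(T)⁻¹ v s̄ - T Q_s(T)⁻¹ v`, which only uses the right multiplication. -/
def rightResolvent (T : ClosedRightOperator V) (s : ℍ) (v : V) : V :=
  pseudoResolvent T s v <• star s - opPseudoResolvent T s v

/-! ### Left multiplications and the S-functional calculus -/

variable (V) in
/-- A left scalar multiplication that turns the right Banach space `V` into a two-sided quaternionic
Banach space: it is additive, associative and unital, it agrees with the right multiplication for
real scalars and it satisfies `‖a v‖ = |a| ‖v‖`. It is not required that `(a v) b = a (v b)`, so
that the multiplications which have this property are included as a special case. -/
structure LeftMultiplication where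
  mul : ℍ →ₐ[ℝ] (V →L[ℝ] V)
  norm_mul : ∀ (a : ℍ) (v : V), ‖mul a v‖ = ‖a‖ * ‖v‖

/-- `Q_s(T)⁻¹` as an element of the real Banach space of bounded operators. -/
def pseudoResolventReal (T : ClosedRightOperator V) (s : ℍ) : V →L[ℝ] V :=
  (pseudoResolvent T s).restrictScalars ℝ

/-- The left S-resolvent `Q_s(T)⁻¹ s̄ - T Q_s(T)⁻¹`, where `(A a) v = A (a v)`. -/
def leftSResolvent (L : LeftMultiplication V) (T : ClosedRightOperator V) (s : ℍ) : V →L[ℝ] V :=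
  pseudoResolventReal T s ∘L L.mul (star s) - opPseudoResolvent T s

/-- The right S-resolvent `-(T - I s̄) Q_s(T)⁻¹`, where `(a A) v = a (A v)`. -/
def rightSResolvent (L : LeftMultiplication V) (T : ClosedRightOperator V) (s : ℍ) : V →L[ℝ] V :=
  -(opPseudoResolvent T s - L.mul (star s) ∘L pseudoResolventReal T s)

/-- `f` is an intrinsic slice hyperholomorphic function with domain `D` that belongs to the
admissible class of `T`: it is defined on a neighbourhood of the S-spectrum and, if `T` is
unbounded, it is also slice hyperholomorphic at infinity. -/
def IsAdmissibleFunction (T : ClosedRightOperator V) (f : ℍ → ℍ) (D : Set ℍ) : Prop :=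
  IsIntrinsicSliceHyperholomorphic f D ∧ sSpectrum T ⊆ D ∧
    (¬ IsBoundedOperator T.op → ∃ c, HasValueAtInfinity f D c)

/-- `U` is a slice Cauchy domain over which `f(T)` can be computed, and `c` is the constant that
goes with it: `U` is unbounded and `c = f(∞)` or, for bounded `T`, `U` is bounded and `c = 0` (which
amounts to extending `f` by zero to a neighbourhood of infinity). -/
def IsAdmissibleDomain (T : ClosedRightOperator V) (f : ℍ → ℍ) (D U : Set ℍ) (c : ℍ) : Prop :=
  IsSliceCauchyDomain U ∧ sSpectrum T ⊆ U ∧ closure U ⊆ D ∧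
    ((¬ Bornology.IsBounded U ∧ HasValueAtInfinity f D c) ∨
      (IsBoundedOperator T.op ∧ Bornology.IsBounded U ∧ c = 0))

/-- `c I + (2π)⁻¹ ∫ S_L⁻¹(s,T) ds_i f(s)` with `ds_i = -i ds`, along the curves `γ` in `ℂ_i`. -/
def leftSCauchyIntegral (L : LeftMultiplication V) (T : ClosedRightOperator V) (f : ℍ → ℍ) (c : ℍ)
    (i : ImagUnit) {n : ℕ} (γ : Fin n → ℝ → ℂ) : V →L[ℝ] V :=
  L.mul c + (2 * Real.pi)⁻¹ • curvesIntegral γ (fun z dz =>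
    leftSResolvent L T (planeHom i z) ∘L L.mul (-i.1 * planeHom i dz * f (planeHom i z)))

/-- `c I + (2π)⁻¹ ∫ f(s) ds_i S_R⁻¹(s,T)` with `ds_i = -i ds`, along the curves `γ` in `ℂ_i`. -/
def rightSCauchyIntegral (L : LeftMultiplication V) (T : ClosedRightOperator V) (f : ℍ → ℍ) (c : ℍ)
    (i : ImagUnit) {n : ℕ} (γ : Fin n → ℝ → ℂ) : V →L[ℝ] V :=
  L.mul c + (2 * Real.pi)⁻¹ • curvesIntegral γ (fun z dz =>
    L.mul (f (planeHom i z) * (-i.1 * planeHom i dz)) ∘L rightSResolvent L T (planeHom i z))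

/-- `A = f(T)` in the sense of the S-functional calculus on `V` with the left multiplication `L`,
computed with some choice of the imaginary unit and of the slice Cauchy domain, in the left or in
the right slice hyperholomorphic version. -/
def IsSFunctionalCalculus (L : LeftMultiplication V) (T : ClosedRightOperator V) (f : ℍ → ℍ)
    (D : Set ℍ) (A : V →L[ℝ] V) : Prop :=
  ∃ (i : ImagUnit) (U : Set ℍ) (c : ℍ) (n : ℕ) (γ : Fin n → ℝ → ℂ),
    IsAdmissibleDomain T f D U c ∧ IsPositiveBoundary γ (slice i U) ∧
    (A = leftSCauchyIntegral L T f c i γ ∨ A = rightSCauchyIntegral L T f c i γ)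

end Quaternionic

/-! ### The complex Banach space `V_i` -/

/-- `V` considered as a complex Banach space, with `z v := v (x₀ + i x₁)` for `z = x₀ + √-1 x₁`. -/
def SliceSpace (_i : ImagUnit) (V : Type*) : Type _ := V

section SliceSpace

variable {V : Type*} [NormedAddCommGroup V] [NormedSpace ℝ V] [CompleteSpace V]
  [Module ℍᵐᵒᵖ V] [IsScalarTower ℝ ℍᵐᵒᵖ V] [NormSMulClass ℍᵐᵒᵖ V] (i : ImagUnit)

instance SliceSpace.instNormedAddCommGroup : NormedAddCommGroup (SliceSpace i V) :=
  inferInstanceAs (NormedAddCommGroup V)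

instance SliceSpace.instCompleteSpace : CompleteSpace (SliceSpace i V) :=
  inferInstanceAs (CompleteSpace V)

/-- The identity `V → V_i`. -/
def toSlice : V ≃+ SliceSpace i V := AddEquiv.refl V

instance SliceSpace.instModule : Module ℂ (SliceSpace i V) :=
  Module.compHom V ((planeHom i : ℂ →+* ℍ).toOpposite fun x y => by
    change planeHom i x * planeHom i y = planeHom i y * planeHom i x
    rw [← map_mul, mul_comm, map_mul])

instance SliceSpace.instNormedSpace : NormedSpace ℂ (SliceSpace i V) where
  norm_smul_le z v := by
    have h : ∀ w : V, ‖w <• planeHom i z‖ = ‖z‖ * ‖w‖ := fun w => by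
      rw [norm_smul, MulOpposite.norm_op, norm_planeHom]
    exact (h v).le

/-- A right linear operator `T`, considered as a `ℂ_i`-linear operator on `V_i`. -/
def sliceOperator (T : ClosedRightOperator V) : SliceSpace i V →ₗ.[ℂ] SliceSpace i V where
  domain :=
    { carrier := (T.op.domain : Set V)
      add_mem' := fun ha hb => T.op.domain.add_mem ha hb
      zero_mem' := T.op.domain.zero_mem
      smul_mem' := fun z _ hv => T.op.domain.smul_mem (MulOpposite.op (planeHom i z)) hv }
  toFun :=
    { toFun := fun u => toSlice i (T.op ⟨(toSlice i).symm u.1, u.2⟩)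
      map_add' := fun u w => T.op.map_add ⟨_, u.2⟩ ⟨_, w.2⟩
      map_smul' := fun z u => T.op.map_smul (MulOpposite.op (planeHom i z)) ⟨_, u.2⟩ }

/-- The restriction `f_i` of `f` to the plane `ℂ_i`, as a function on `ℂ`. -/
def sliceFunction (f : ℍ → ℍ) (z : ℂ) : ℂ := planeCoord i (f (planeHom i z))

end SliceSpace

end

/-! For `s` in `ℂ_i` and in the S-resolvent set, `Q_s(T)` factors on `V_i` into `T - s` and `T -
s̄`, the scalars acting from the right. Therefore `v ↦ R_s(T; v)` is exactly the resolvent of the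
complex linear operator `T` on `V_i` (`isBoundedInverse_sliceResolvent`), and the integral with
`R_z(T; v)` is a Riesz-Dunford integral evaluated at `v`.

To compare it with the S-functional calculus, multiply the resolvent by the weight `w = -i f(s) ds`
in `ℂ_i` and split `w s̄` and `w` into real and imaginary parts. The integrand becomes a real
component plus `i` times an imaginary one, and both (`planeKernel`) are combinations of `Q_s(T)⁻¹`
and `T Q_s(T)⁻¹` with real coefficients. The left and the right S-resolvent produce the same two
components. The only difference is how `i` acts on the imaginary one: by right multiplication, by
left multiplication before it, or by left multiplication after it.

So everything agrees once the imaginary component integrates to zero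
(`sum_integral_planeKernel_im`). The slice of an axially symmetric domain is invariant under
conjugation, and its reflected boundary with reversed direction is again positively oriented. By
Cauchy's theorem both boundaries give the same Riesz-Dunford integral. Since `f` is intrinsic and
`Q_s(T)` depends only on `Re s` and `|s|`, reflection keeps the real component and changes the sign
of the imaginary one. What is left is `sCauchyOp`, which involves real scalars only and is the same
for all imaginary units; the constant `f(∞)` is real as well.

Independence of the domain is `rieszDunford_integral_unique`. It rests on Dixon's proof of the
global Cauchy theorem, stated for curves with weights so that reflected boundaries and circles are
covered. A bounded and an unbounded domain are compared through a large circle, whose integral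
supplies the term `f(∞)`. -/

noncomputable section

set_option linter.unusedSectionVars false

/-! ### Cauchy's theorem for weighted families of curves -/

section CauchyTheorem

open MeasureTheory

theorem ContinuousOn.aestronglyMeasurable_uIoc {E : Type*} [NormedAddCommGroup E]
    {φ : ℝ → E} (hφ : ContinuousOn φ (Icc (0 : ℝ) 1)) :
    AEStronglyMeasurable φ (volume.restrict (uIoc (0 : ℝ) 1)) := by
  rw [uIoc_of_le zero_le_one]
  exact (hφ.mono Ioc_subset_Icc_self).aestronglyMeasurable measurableSet_Ioc

variable {E : Type*} [NormedAddCommGroup E] [NormedSpace ℂ E]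

theorem IntervalIntegrable.smul_of_bounded {ρ : ℝ → ℂ} {φ : ℝ → E} {M : ℝ}
    (hρ : IntervalIntegrable ρ volume 0 1)
    (hφ : AEStronglyMeasurable φ (volume.restrict (uIoc (0 : ℝ) 1)))
    (hM : ∀ t ∈ Icc (0 : ℝ) 1, ‖φ t‖ ≤ M) :
    IntervalIntegrable (fun t => ρ t • φ t) volume 0 1 := by
  refine (hρ.norm.mul_const M).mono_fun (hρ.def'.aestronglyMeasurable.smul hφ) ?_
  refine (ae_restrict_iff' measurableSet_uIoc).2 (Eventually.of_forall fun t ht => ?_)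
  rw [uIoc_of_le zero_le_one] at ht
  have := hM t ⟨ht.1.le, ht.2⟩
  simp only [norm_smul, norm_mul, norm_norm]
  gcongr
  exact this.trans (le_abs_self M)

theorem IntervalIntegrable.smul_continuousOn_Icc {ρ : ℝ → ℂ} {φ : ℝ → E}
    (hρ : IntervalIntegrable ρ volume 0 1) (hφ : ContinuousOn φ (Icc (0 : ℝ) 1)) :
    IntervalIntegrable (fun t => ρ t • φ t) volume 0 1 := by
  obtain ⟨M, hM⟩ := isCompact_Icc.exists_bound_of_continuousOn hφ
  exact hρ.smul_of_bounded hφ.aestronglyMeasurable_uIoc hM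

/-- A weighted integral of a locally bounded family of holomorphic functions is holomorphic. -/
theorem differentiableOn_intervalIntegral_smul {k : ℂ → ℝ → E} {ρ : ℝ → ℂ} {S : Set ℂ}
    (hS : IsOpen S) (hρ : IntervalIntegrable ρ volume 0 1)
    (hmeas : ∀ z, AEStronglyMeasurable (k z) (volume.restrict (uIoc (0 : ℝ) 1)))
    (hdiff : ∀ t ∈ Icc (0 : ℝ) 1, DifferentiableOn ℂ (fun z => k z t) S)
    (hbound : ∀ z₀ ∈ S, ∃ M : ℝ, ∃ ε > 0, ∀ z ∈ Metric.ball z₀ ε, ∀ t ∈ Icc (0 : ℝ) 1,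
      ‖k z t‖ ≤ M) :
    DifferentiableOn ℂ (fun z => ∫ t in (0 : ℝ)..1, ρ t • k z t) S := by
  intro z₀ hz₀
  obtain ⟨M, ε, hε, hM⟩ := hbound z₀ hz₀
  obtain ⟨δ, hδ, hδS⟩ := Metric.isOpen_iff.1 hS z₀ hz₀
  -- Every closed disc of radius `r / 2` around a point of `ball z₀ r` stays inside `ball z₀ (2 *
  -- r)`, where the kernel is both holomorphic and bounded by `M`; Cauchy's estimate then bounds the
  -- derivative by `M / (r / 2)`.
  set r := min ε δ / 2 with hr
  have hr0 : 0 < r := by positivity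
  have hrε : 2 * r ≤ ε := by rw [hr]; linarith [min_le_left ε δ]
  have hrδ : 2 * r ≤ δ := by rw [hr]; linarith [min_le_right ε δ]
  have hI : ∀ t, t ∈ uIoc (0 : ℝ) 1 → t ∈ Icc (0 : ℝ) 1 := fun t ht => by
    rw [uIoc_of_le zero_le_one] at ht; exact ⟨ht.1.le, ht.2⟩
  have hat : ∀ t ∈ Icc (0 : ℝ) 1, ∀ z ∈ Metric.ball z₀ (2 * r),
      DifferentiableAt ℂ (fun z => k z t) z := fun t ht z hz =>
    (hdiff t ht).differentiableAt (hS.mem_nhds (hδS (Metric.ball_subset_ball hrδ hz)))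
  have hρm : AEStronglyMeasurable ρ (volume.restrict (uIoc (0 : ℝ) 1)) := hρ.def'.aestronglyMeasurable
  -- The derivative is measurable in `t` as a limit of difference quotients.
  have hdm : AEStronglyMeasurable (fun t => deriv (fun z => k z t) z₀)
      (volume.restrict (uIoc (0 : ℝ) 1)) := by
    refine aestronglyMeasurable_of_tendsto_ae (𝓝[≠] z₀)
      (f := fun z t => slope (fun z => k z t) z₀ z) (fun z => ?_) ?_
    · simp only [slope_def_module]
      exact ((hmeas z).sub (hmeas z₀)).const_smul _
    · refine (ae_restrict_iff' measurableSet_uIoc).2 (Eventually.of_forall fun t ht => ?_)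
      exact hasDerivAt_iff_tendsto_slope.1
        (hat t (hI t ht) z₀ (Metric.mem_ball_self (by positivity))).hasDerivAt
  have hderiv : ∀ t ∈ Icc (0 : ℝ) 1, ∀ z ∈ Metric.ball z₀ r,
      ‖deriv (fun z => k z t) z‖ ≤ M / (r / 2) := fun t ht z hz => by
    have hsub : Metric.closedBall z (r / 2) ⊆ Metric.ball z₀ (2 * r) := fun w hw => by
      rw [Metric.mem_closedBall] at hw
      rw [Metric.mem_ball] at hz ⊢
      linarith [dist_triangle w z z₀]
    refine Complex.norm_deriv_le_of_forall_mem_sphere_norm_le (by positivity) ?_ fun w hw =>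
      hM w (Metric.ball_subset_ball hrε (hsub (Metric.sphere_subset_closedBall hw))) t ht
    refine DifferentiableOn.diffContOnCl fun w hw => ?_
    rw [closure_ball _ (by positivity)] at hw
    exact (hat t ht w (hsub hw)).differentiableWithinAt
  refine (intervalIntegral.hasDerivAt_integral_of_dominated_loc_of_deriv_le
    (F' := fun z t => ρ t • deriv (fun z => k z t) z) (bound := fun t => ‖ρ t‖ * (M / (r / 2)))
    (Metric.ball_mem_nhds z₀ hr0) (Eventually.of_forall fun z => hρm.smul (hmeas z)) ?_
    (hρm.smul hdm) (ae_of_all _ fun t ht z hz => ?_) (hρ.norm.mul_const _)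
    (ae_of_all _ fun t ht z hz => ?_)).2.differentiableAt.differentiableWithinAt
  · exact hρ.smul_of_bounded (hmeas z₀) (hM z₀ (Metric.mem_ball_self hε))
  · rw [norm_smul]
    gcongr
    exact hderiv t (hI t ht) z hz
  · exact ((hat t (hI t ht) z
      (Metric.ball_subset_ball (by linarith) hz)).hasDerivAt).const_smul _

theorem continuousOn_dslope_of_differentiableOn {F : ℂ → E} {S : Set ℂ} (hS : IsOpen S)
    (hF : DifferentiableOn ℂ F S) (z : ℂ) : ContinuousOn (dslope F z) S := by
  by_cases hz : z ∈ S
  · exact (continuousOn_dslope (hS.mem_nhds hz)).2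
      ⟨hF.continuousOn, hF.differentiableAt (hS.mem_nhds hz)⟩
  · intro w hw
    exact (continuousWithinAt_dslope_of_ne fun h : w = z => hz (h ▸ hw)).2 (hF.continuousOn w hw)

/-- The symmetry gives holomorphy of Dixon's kernel in the variable `z` from the known holomorphy in
`w`. -/
theorem dslope_comm (F : ℂ → E) (z w : ℂ) : dslope F z w = dslope F w z := by
  rcases eq_or_ne w z with rfl | h
  · rfl
  · rw [dslope_of_ne F h, dslope_of_ne F h.symm, slope_comm]

/-- For `w` in a disc around `z₀` the mean value inequality bounds the difference quotient by the
derivative; for the other `w` the denominator is at least `δ / 2`. This is the local bound needed to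
differentiate under the integral. -/
theorem exists_bound_dslope [CompleteSpace E] {F : ℂ → E} {S K : Set ℂ} (hS : IsOpen S)
    (hF : DifferentiableOn ℂ F S) (hK : IsCompact K) (hKS : K ⊆ S) {z₀ : ℂ} (hz₀ : z₀ ∈ S) :
    ∃ M : ℝ, ∃ ε > 0, ∀ z ∈ Metric.ball z₀ ε, ∀ w ∈ K, ‖dslope F z w‖ ≤ M := by
  obtain ⟨δ, hδ, hδS⟩ := Metric.nhds_basis_closedBall.mem_iff.1 (hS.mem_nhds hz₀)
  have hB : IsCompact (Metric.closedBall z₀ δ) := isCompact_closedBall _ _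
  obtain ⟨M₁, hM₁⟩ := hK.exists_bound_of_continuousOn (hF.continuousOn.mono hKS)
  obtain ⟨M₂, hM₂⟩ := hB.exists_bound_of_continuousOn (hF.continuousOn.mono hδS)
  obtain ⟨M₃, hM₃⟩ := hB.exists_bound_of_continuousOn ((hF.deriv hS).continuousOn.mono hδS)
  refine ⟨max M₃ ((δ / 2)⁻¹ * (M₁ + M₂)), δ / 2, by positivity, fun z hz w hw => ?_⟩
  have hzB : z ∈ Metric.closedBall z₀ δ :=
    Metric.ball_subset_closedBall (Metric.ball_subset_ball (by linarith) hz)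
  by_cases hwB : w ∈ Metric.closedBall z₀ δ
  · refine le_max_of_le_left ?_
    rcases eq_or_ne w z with rfl | hne
    · rw [dslope_same]; exact hM₃ _ hwB
    · have := (convex_closedBall z₀ δ).norm_image_sub_le_of_norm_deriv_le
        (fun x hx => hF.differentiableAt (hS.mem_nhds (hδS hx))) hM₃ hzB hwB
      rw [dslope_of_ne F hne, slope_def_module, norm_smul, norm_inv]
      have h0 : 0 < ‖w - z‖ := norm_pos_iff.2 (sub_ne_zero.2 hne)
      rw [inv_mul_le_iff₀ h0, mul_comm]
      exact this
  · refine le_max_of_le_right ?_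
    rw [Metric.mem_closedBall, not_le] at hwB
    rw [Metric.mem_ball] at hz
    have hd : δ / 2 ≤ ‖w - z‖ := by
      rw [← dist_eq_norm]; linarith [dist_triangle w z z₀]
    have hne : w ≠ z := by
      rintro rfl
      simp at hd
      linarith
    rw [dslope_of_ne F hne, slope_def_module, norm_smul, norm_inv]
    gcongr
    exact (norm_sub_le _ _).trans (add_le_add (hM₁ w hw) (hM₂ z hzB))

theorem differentiableOn_cauchyTransform {γ ρ : ℝ → ℂ} {φ : ℝ → E} {S : Set ℂ} (hS : IsOpen S)
    (hγ : ContinuousOn γ (Icc 0 1)) (hρ : IntervalIntegrable ρ volume 0 1)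
    (hφ : ContinuousOn φ (Icc (0 : ℝ) 1)) (hγS : ∀ t ∈ Icc (0 : ℝ) 1, γ t ∉ S) :
    DifferentiableOn ℂ (fun z => ∫ t in (0 : ℝ)..1, ρ t • (γ t - z)⁻¹ • φ t) S := by
  refine differentiableOn_intervalIntegral_smul hS hρ (fun z => ?_) (fun t ht => ?_) ?_
  · refine AEStronglyMeasurable.smul ?_ hφ.aestronglyMeasurable_uIoc
    exact ((hγ.aestronglyMeasurable_uIoc.aemeasurable.sub_const z).inv).aestronglyMeasurable
  · refine DifferentiableOn.smul_const ?_ _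
    refine DifferentiableOn.inv (by fun_prop) fun z hz h => hγS t ht ?_
    rwa [sub_eq_zero.1 h]
  · intro z₀ hz₀
    obtain ⟨δ, hδ, hδS⟩ := Metric.isOpen_iff.1 hS z₀ hz₀
    obtain ⟨M, hM⟩ := isCompact_Icc.exists_bound_of_continuousOn hφ
    refine ⟨(δ / 2)⁻¹ * M, δ / 2, by positivity, fun z hz t ht => ?_⟩
    have h1 : δ ≤ dist (γ t) z₀ := by
      by_contra! h
      exact hγS t ht (hδS h)
    rw [Metric.mem_ball] at hz
    have hd : δ / 2 ≤ ‖γ t - z‖ := by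
      rw [← dist_eq_norm]; linarith [dist_triangle (γ t) z z₀]
    rw [norm_smul, norm_inv]
    gcongr
    exact hM t ht

/-- If the curve lies in the ball of radius `N`, the kernel is at most `(‖z‖ - N)⁻¹`. -/
theorem tendsto_cauchyTransform_cobounded {γ ρ : ℝ → ℂ} {φ : ℝ → E}
    (hγ : ContinuousOn γ (Icc 0 1)) (hρ : IntervalIntegrable ρ volume 0 1)
    (hφ : ContinuousOn φ (Icc (0 : ℝ) 1)) :
    Tendsto (fun z => ∫ t in (0 : ℝ)..1, ρ t • (γ t - z)⁻¹ • φ t) (Bornology.cobounded ℂ)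
      (𝓝 0) := by
  obtain ⟨M, hM⟩ := isCompact_Icc.exists_bound_of_continuousOn hφ
  obtain ⟨N, hN⟩ := isCompact_Icc.exists_bound_of_continuousOn hγ
  set J := ∫ t in (0 : ℝ)..1, ‖ρ t‖ * |M|
  have hlim : Tendsto (fun z : ℂ => (‖z‖ - N)⁻¹ * J) (Bornology.cobounded ℂ) (𝓝 0) := by
    have h1 : Tendsto (fun z : ℂ => ‖z‖ - N) (Bornology.cobounded ℂ) atTop :=
      tendsto_atTop_add_const_right _ _ tendsto_norm_cobounded_atTop
    simpa using h1.inv_tendsto_atTop.mul_const J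
  refine squeeze_zero_norm' ?_ hlim
  have hev : ∀ᶠ z : ℂ in Bornology.cobounded ℂ, N < ‖z‖ :=
    tendsto_norm_cobounded_atTop.eventually_gt_atTop N
  filter_upwards [hev] with z hz
  rw [← intervalIntegral.integral_const_mul]
  refine intervalIntegral.norm_integral_le_of_norm_le zero_le_one ?_
    ((hρ.norm.mul_const _).const_mul _)
  refine ae_of_all _ fun t ht => ?_
  have ht' : t ∈ Icc (0 : ℝ) 1 := ⟨ht.1.le, ht.2⟩
  have h1 : ‖z‖ - N ≤ ‖γ t - z‖ := by
    have := norm_sub_norm_le z (γ t)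
    rw [norm_sub_rev] at this
    linarith [hN t ht']
  have h0 : 0 < ‖z‖ - N := by linarith
  rw [norm_smul, norm_smul, norm_inv]
  calc ‖ρ t‖ * (‖γ t - z‖⁻¹ * ‖φ t‖) ≤ ‖ρ t‖ * ((‖z‖ - N)⁻¹ * |M|) := by
        gcongr
        exact (hM t ht').trans (le_abs_self M)
    _ = _ := by ring

/-- Cauchy's theorem for a finite family of weighted curves `γ l` in an open set `S` (Dixon's
proof): if the Cauchy transform `∑ l, ∫ ρ l t / (γ l t - z)` vanishes on an open set `S'` that
contains the complement of `S` and a neighbourhood of infinity, then the corresponding integral of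
every holomorphic function on `S` vanishes. -/
theorem sum_intervalIntegral_eq_zero_of_cauchyTransform_eq_zero [CompleteSpace E] {ι : Type*}
    [Fintype ι] {γ ρ : ι → ℝ → ℂ} {S S' : Set ℂ} (hS : IsOpen S) (hS' : IsOpen S')
    (hcover : ∀ z, z ∉ S → z ∈ S') (hinf : ∀ᶠ z in Bornology.cobounded ℂ, z ∈ S')
    (hγ : ∀ l, ContinuousOn (γ l) (Icc 0 1)) (hρ : ∀ l, IntervalIntegrable (ρ l) volume 0 1)
    (hγS : ∀ l, ∀ t ∈ Icc (0 : ℝ) 1, γ l t ∈ S) (hγS' : ∀ l, ∀ t ∈ Icc (0 : ℝ) 1, γ l t ∉ S')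
    (hind : ∀ z ∈ S', ∑ l, ∫ t in (0 : ℝ)..1, ρ l t / (γ l t - z) = 0)
    {F : ℂ → E} (hF : DifferentiableOn ℂ F S) :
    ∑ l, ∫ t in (0 : ℝ)..1, ρ l t • F (γ l t) = 0 := by
  classical
  have key : ∀ G : ℂ → E, DifferentiableOn ℂ G S → ∀ z ∈ S',
      ∑ l, ∫ t in (0 : ℝ)..1, ρ l t • (γ l t - z)⁻¹ • G (γ l t) = 0 := by
    intro G hG
    -- Dixon's two functions: `h₁` is holomorphic on `S`, `h₂` on `S'`. On `S'` they differ by `G z`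
    -- times the Cauchy transform of the weights, which vanishes there. Glued together they form an
    -- entire function that tends to zero at infinity, hence zero by Liouville.
    set h₁ : ℂ → E := fun z => ∑ l, ∫ t in (0 : ℝ)..1, ρ l t • dslope G z (γ l t) with hh₁
    set h₂ : ℂ → E := fun z => ∑ l, ∫ t in (0 : ℝ)..1, ρ l t • (γ l t - z)⁻¹ • G (γ l t) with hh₂
    have hGγ : ∀ l, ContinuousOn (fun t => G (γ l t)) (Icc (0 : ℝ) 1) := fun l =>
      hG.continuousOn.comp (hγ l) (hγS l)
    have d₁ : DifferentiableOn ℂ h₁ S := by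
      refine DifferentiableOn.fun_sum fun l _ => ?_
      refine differentiableOn_intervalIntegral_smul hS (hρ l) (fun z => ?_) (fun t ht => ?_) ?_
      · exact ((continuousOn_dslope_of_differentiableOn hS hG z).comp (hγ l)
          (hγS l)).aestronglyMeasurable_uIoc
      · simp_rw [dslope_comm G _ (γ l t)]
        exact (Complex.differentiableOn_dslope (hS.mem_nhds (hγS l t ht))).2 hG
      · intro z₀ hz₀
        obtain ⟨M, ε, hε, hM⟩ := exists_bound_dslope hS hG (isCompact_Icc.image_of_continuousOn (hγ l))
          (image_subset_iff.2 (hγS l)) hz₀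
        exact ⟨M, ε, hε, fun z hz t ht => hM z hz _ (mem_image_of_mem _ ht)⟩
    have d₂ : DifferentiableOn ℂ h₂ S' :=
      DifferentiableOn.fun_sum fun l _ =>
        differentiableOn_cauchyTransform hS' (hγ l) (hρ l) (hGγ l) (hγS' l)
    have heq : ∀ z ∈ S', h₁ z = h₂ z := by
      intro z hz
      have hne : ∀ l, ∀ t ∈ Icc (0 : ℝ) 1, γ l t - z ≠ 0 := fun l t ht h =>
        hγS' l t ht (by rwa [sub_eq_zero.1 h])
      have hcinv : ∀ l, ContinuousOn (fun t => (γ l t - z)⁻¹) (Icc (0 : ℝ) 1) := fun l =>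
        ((hγ l).sub continuousOn_const).inv₀ (hne l)
      have h1 : ∀ l, ∫ t in (0 : ℝ)..1, ρ l t • dslope G z (γ l t) =
          (∫ t in (0 : ℝ)..1, ρ l t • (γ l t - z)⁻¹ • G (γ l t)) -
            (∫ t in (0 : ℝ)..1, ρ l t / (γ l t - z)) • G z := by
        intro l
        rw [← intervalIntegral.integral_smul_const, ← intervalIntegral.integral_sub]
        · refine intervalIntegral.integral_congr fun t ht => ?_
          rw [uIcc_of_le zero_le_one] at ht
          have h0 := hne l t ht
          rw [dslope_of_ne G (sub_ne_zero.1 h0), slope_def_module, smul_sub, smul_sub,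
            div_eq_mul_inv, mul_smul]
        · exact (hρ l).smul_continuousOn_Icc ((hcinv l).smul (hGγ l))
        · simp_rw [div_eq_mul_inv, mul_smul]
          exact (hρ l).smul_continuousOn_Icc ((hcinv l).smul continuousOn_const)
      change ∑ l, ∫ t in (0 : ℝ)..1, ρ l t • dslope G z (γ l t) = _
      rw [Finset.sum_congr rfl fun l _ => h1 l, Finset.sum_sub_distrib, ← Finset.sum_smul,
        hind z hz, zero_smul, sub_zero]
    set h : ℂ → E := fun z => if z ∈ S' then h₂ z else h₁ z with hh
    have hd : Differentiable ℂ h := by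
      intro z
      by_cases hz : z ∈ S'
      · refine ((d₂ z hz).differentiableAt (hS'.mem_nhds hz)).congr_of_eventuallyEq ?_
        filter_upwards [hS'.mem_nhds hz] with w hw
        simp [hh, hw]
      -- Off `S'` the point lies in `S`; as `h₁` and `h₂` agree on all of `S'`, the glued function
      -- equals `h₁` everywhere, in particular near this point.
      · have hzS : z ∈ S := by
          by_contra h'
          exact hz (hcover z h')
        refine ((d₁ z hzS).differentiableAt (hS.mem_nhds hzS)).congr_of_eventuallyEq ?_
        refine Eventually.of_forall fun w => ?_
        by_cases hw : w ∈ S'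
        · simp [hh, hw, heq w hw]
        · simp [hh, hw]
    have hlim₂ : Tendsto h₂ (Bornology.cobounded ℂ) (𝓝 0) := by
      have : Tendsto h₂ (Bornology.cobounded ℂ) (𝓝 (∑ _l : ι, (0 : E))) :=
        tendsto_finsetSum _ fun l _ => tendsto_cauchyTransform_cobounded (hγ l) (hρ l) (hGγ l)
      simpa using this
    have hlim : Tendsto h (cocompact ℂ) (𝓝 0) := by
      rw [← Metric.cobounded_eq_cocompact]
      refine hlim₂.congr' ?_
      filter_upwards [hinf] with z hz
      simp [hh, hz]
    intro z hz
    have := hd.apply_eq_of_tendsto_cocompact z hlim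
    simpa [hh, hz] using this
  -- Inserting `(w - z) F(w)` into the vanishing Cauchy integral cancels the kernel; any point of
  -- `S'` serves as `z`.
  obtain ⟨z, hz⟩ := hinf.exists
  have := key (fun w => (w - z) • F w) (by fun_prop) z hz
  rw [← this]
  refine Finset.sum_congr rfl fun l _ => intervalIntegral.integral_congr fun t ht => ?_
  rw [uIcc_of_le zero_le_one] at ht
  have h0 : γ l t - z ≠ 0 := fun h => hγS' l t ht (by rwa [sub_eq_zero.1 h])
  rw [inv_smul_smul₀ h0]

end CauchyTheorem

/-! ### Comparison of integrals over the boundaries of two domains -/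

section WeightedBoundary

open MeasureTheory

open Classical in
/-- The curves `γ l` with the weights `ρ l` have values in the frontier of `W` and the index that
a positively oriented boundary of `W` has. -/
structure IsWeightedBoundary {ι : Type*} [Fintype ι] (γ ρ : ι → ℝ → ℂ) (W : Set ℂ) : Prop where
  isOpen : IsOpen W
  isBounded_frontier : Bornology.IsBounded (frontier W)
  continuousOn : ∀ l, ContinuousOn (γ l) (Icc 0 1)
  intervalIntegrable : ∀ l, IntervalIntegrable (ρ l) volume 0 1
  mem_frontier : ∀ l, ∀ t ∈ Icc (0 : ℝ) 1, γ l t ∈ frontier W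
  index_inside : ∀ z ∈ W, ∑ l, ∫ t in (0 : ℝ)..1, ρ l t / (γ l t - z) =
    if Bornology.IsBounded W then 2 * Real.pi * Complex.I else 0
  index_outside : ∀ z ∉ closure W, ∑ l, ∫ t in (0 : ℝ)..1, ρ l t / (γ l t - z) =
    if Bornology.IsBounded W then 0 else -(2 * Real.pi * Complex.I)

namespace IsWeightedBoundary

variable {ι ι' : Type*} [Fintype ι] [Fintype ι'] {γ ρ : ι → ℝ → ℂ} {γ' ρ' : ι' → ℝ → ℂ}
  {W W' : Set ℂ}

/-- The Cauchy transform of the weights tends to zero at infinity, whereas it is `-2πi` outside the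
closure of an unbounded `W`. Points far away are thus in the closure, and not in the bounded
frontier. -/
theorem eventually_mem (h : IsWeightedBoundary γ ρ W) (hW : ¬ Bornology.IsBounded W) :
    ∀ᶠ z in Bornology.cobounded ℂ, z ∈ W := by
  have hlim : Tendsto (fun z => ∑ l, ∫ t in (0 : ℝ)..1, ρ l t / (γ l t - z))
      (Bornology.cobounded ℂ) (𝓝 0) := by
    have : Tendsto (fun z => ∑ l, ∫ t in (0 : ℝ)..1, ρ l t • (γ l t - z)⁻¹ • (1 : ℂ))
        (Bornology.cobounded ℂ) (𝓝 (∑ _l : ι, (0 : ℂ))) :=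
      tendsto_finsetSum _ fun l _ => tendsto_cauchyTransform_cobounded (h.continuousOn l)
        (h.intervalIntegrable l) continuousOn_const
    simpa [div_eq_mul_inv] using this
  have hne : (0 : ℂ) ≠ -(2 * Real.pi * Complex.I) := by
    simp [Real.pi_ne_zero]
  have hfr : ∀ᶠ z in Bornology.cobounded ℂ, z ∉ frontier W := h.isBounded_frontier
  filter_upwards [hlim.eventually_ne hne, hfr] with z hz hzf
  by_contra hzW
  have hzc : z ∉ closure W := fun hc => hzf ⟨hc, by rwa [h.isOpen.interior_eq]⟩
  exact hz (by rw [h.index_outside z hzc, if_neg hW])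

theorem eventually_notMem_closure (hW : Bornology.IsBounded W) :
    ∀ᶠ z in Bornology.cobounded ℂ, z ∉ closure W :=
  hW.closure

theorem notMem_inter_union_of_mem_frontier (h : IsOpen W) {z : ℂ} (hz : z ∈ frontier W) {X Y : Set ℂ} :
    z ∉ (W ∩ X) ∪ ((closure W)ᶜ ∩ Y) := by
  rintro (⟨h1, -⟩ | ⟨h1, -⟩)
  · exact hz.2 (by rwa [h.interior_eq])
  · exact h1 hz.1

variable {E : Type*} [NormedAddCommGroup E] [NormedSpace ℂ E] [CompleteSpace E]

/-- The difference of the two boundaries has index zero in the common interior and in the common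
exterior, and these contain the complement of `S`. So Cauchy's theorem applies to the difference. -/
theorem sum_integral_eq (h : IsWeightedBoundary γ ρ W) (h' : IsWeightedBoundary γ' ρ' W')
    (hb : Bornology.IsBounded W ↔ Bornology.IsBounded W') {S : Set ℂ} (hS : IsOpen S)
    (hWS : frontier W ⊆ S) (hWS' : frontier W' ⊆ S)
    (hcover : ∀ z ∉ S, z ∈ W ∩ W' ∪ (closure W)ᶜ ∩ (closure W')ᶜ) {F : ℂ → E}
    (hF : DifferentiableOn ℂ F S) :
    ∑ l, ∫ t in (0 : ℝ)..1, ρ l t • F (γ l t) = ∑ l, ∫ t in (0 : ℝ)..1, ρ' l t • F (γ' l t) := by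
  have key := sum_intervalIntegral_eq_zero_of_cauchyTransform_eq_zero (ι := ι ⊕ ι')
    (γ := Sum.elim γ γ') (ρ := Sum.elim ρ (fun l t => -ρ' l t)) hS
    ((h.isOpen.inter h'.isOpen).union
      (isClosed_closure.isOpen_compl.inter isClosed_closure.isOpen_compl)) hcover ?_ ?_ ?_ ?_ ?_ ?_
    hF
  · simpa [Fintype.sum_sum_type, ← sub_eq_add_neg, sub_eq_zero] using key
  · by_cases hW : Bornology.IsBounded W
    · filter_upwards [eventually_notMem_closure hW, eventually_notMem_closure (hb.1 hW)]
        with z hz hz'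
      exact Or.inr ⟨hz, hz'⟩
    · filter_upwards [h.eventually_mem hW, h'.eventually_mem fun h => hW (hb.2 h)] with z hz hz'
      exact Or.inl ⟨hz, hz'⟩
  · rintro (l | l)
    exacts [h.continuousOn l, h'.continuousOn l]
  · rintro (l | l)
    exacts [h.intervalIntegrable l, (h'.intervalIntegrable l).neg]
  · rintro (l | l) t ht
    exacts [hWS (h.mem_frontier l t ht), hWS' (h'.mem_frontier l t ht)]
  · rintro (l | l) t ht
    · exact notMem_inter_union_of_mem_frontier h.isOpen (h.mem_frontier l t ht)
    · rw [inter_comm, inter_comm (closure W)ᶜ]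
      exact notMem_inter_union_of_mem_frontier h'.isOpen (h'.mem_frontier l t ht)
  · rintro z (⟨hz, hz'⟩ | ⟨hz, hz'⟩)
    · by_cases hW : Bornology.IsBounded W' <;>
        simp [Fintype.sum_sum_type, neg_div, h.index_inside z hz, h'.index_inside z hz', hb, hW]
    · by_cases hW : Bornology.IsBounded W' <;>
        simp [Fintype.sum_sum_type, neg_div, h.index_outside z hz, h'.index_outside z hz', hb, hW]

omit [CompleteSpace E] in
theorem circleIntegral_eq_intervalIntegral (F : ℂ → E) (r : ℝ) :
    ∮ z in C(0, r), F z = ∫ t in (0 : ℝ)..1,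
      (2 * Real.pi * Complex.I * circleMap 0 r (2 * Real.pi * t)) •
        F (circleMap 0 r (2 * Real.pi * t)) := by
  have := intervalIntegral.smul_integral_comp_mul_left (a := 0) (b := 1)
    (fun θ => deriv (circleMap 0 r) θ • F (circleMap 0 r θ)) (2 * Real.pi)
  rw [circleIntegral]
  simp only [mul_zero, mul_one] at this
  rw [← this, ← intervalIntegral.integral_smul]
  refine intervalIntegral.integral_congr fun t _ => ?_
  simp only [deriv_circleMap]
  rw [← Complex.coe_smul, smul_smul]
  congr 1
  push_cast
  ring

theorem circleIntegral_sub_inv_of_norm_gt {r : ℝ} (hr : 0 < r) {z : ℂ} (hz : r < ‖z‖) :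
    ∮ w in C(0, r), (w - z)⁻¹ = 0 := by
  refine DiffContOnCl.circleIntegral_eq_zero hr.le ?_
  refine DifferentiableOn.diffContOnCl fun w hw => ?_
  rw [closure_ball _ hr.ne', mem_closedBall_zero_iff] at hw
  refine (DifferentiableAt.inv (by fun_prop) fun h => ?_).differentiableWithinAt
  rw [sub_eq_zero.1 h] at hw
  linarith

/-- On the complement of `S` the index of the bounded domain exceeds that of the unbounded one by
one: `1 - 0` inside both, `0 - (-1)` outside both. A large circle makes up for this, and its
integral, divided by `2πi`, converges to `c`. -/
theorem sum_integral_eq_add (h : IsWeightedBoundary γ ρ W) (h' : IsWeightedBoundary γ' ρ' W')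
    (hW : Bornology.IsBounded W) (hW' : ¬ Bornology.IsBounded W') {S : Set ℂ} (hS : IsOpen S)
    (hWS : frontier W ⊆ S) (hWS' : frontier W' ⊆ S)
    (hcover : ∀ z ∉ S, z ∈ W ∩ W' ∪ (closure W)ᶜ ∩ (closure W')ᶜ) {F : ℂ → E}
    (hF : DifferentiableOn ℂ F S) {c : E}
    (hc : Tendsto (fun z => z • F z) (Bornology.cobounded ℂ) (𝓝 c)) :
    (2 * Real.pi * Complex.I : ℂ)⁻¹ • ∑ l, ∫ t in (0 : ℝ)..1, ρ l t • F (γ l t) =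
      c + (2 * Real.pi * Complex.I : ℂ)⁻¹ • ∑ l, ∫ t in (0 : ℝ)..1, ρ' l t • F (γ' l t) := by
  have hev : ∀ᶠ z in Bornology.cobounded ℂ, z ∉ closure W ∧ z ∈ W' :=
    (eventually_notMem_closure hW).and (h'.eventually_mem hW')
  obtain ⟨r₀, -, hr₀⟩ := hasBasis_cobounded_norm.eventually_iff.1 hev
  -- Far away, points are outside the closure of `W` but inside `W'`, which excludes both cases of
  -- `hcover`.
  have hSr : ∀ z : ℂ, r₀ ≤ ‖z‖ → z ∈ S := fun z hz => by
    by_contra hzS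
    rcases hcover z hzS with ⟨h1, -⟩ | ⟨-, h1⟩
    exacts [(hr₀ hz).1 (subset_closure h1), h1 (subset_closure (hr₀ hz).2)]
  have hcircle : ∀ r, 0 < r → r₀ < r → ∑ l, ∫ t in (0 : ℝ)..1, ρ l t • F (γ l t) =
      (∮ z in C(0, r), F z) + ∑ l, ∫ t in (0 : ℝ)..1, ρ' l t • F (γ' l t) := by
    intro r hr hr₀r
    have hnorm : ∀ t : ℝ, ‖circleMap 0 r (2 * Real.pi * t)‖ = r := fun t => by
      rw [norm_circleMap_zero, abs_of_pos hr]
    have hcont : Continuous fun t : ℝ => circleMap 0 r (2 * Real.pi * t) := by fun_prop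
    -- The circle and the boundary of `W'` are subtracted. The total index is then `1 - 0 - 1` or `0
    -- - (-1) - 1` inside the circle, and `0 - 0 - 0` beyond it.
    have key := sum_intervalIntegral_eq_zero_of_cauchyTransform_eq_zero (ι := ι ⊕ ι' ⊕ Unit)
      (γ := Sum.elim γ (Sum.elim γ' fun _ t => circleMap 0 r (2 * Real.pi * t)))
      (ρ := Sum.elim ρ (Sum.elim (fun l t => -ρ' l t)
        fun _ t => -(2 * Real.pi * Complex.I * circleMap 0 r (2 * Real.pi * t))))
      (S' := (W ∩ W' ∪ (closure W)ᶜ ∩ (closure W')ᶜ) ∩ Metric.ball 0 r ∪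
        {z | r < ‖z‖} ∩ ((closure W)ᶜ ∩ W')) hS ?_ (fun z hz => ?_) ?_ ?_ ?_ ?_ ?_ ?_ hF
    · simp only [Fintype.sum_sum_type, Sum.elim_inl, Sum.elim_inr, neg_smul,
        intervalIntegral.integral_neg, Finset.sum_neg_distrib, Finset.univ_unique,
        Finset.sum_singleton, ← circleIntegral_eq_intervalIntegral] at key
      rw [← sub_eq_zero, ← key]
      abel
    · exact (((h.isOpen.inter h'.isOpen).union
        (isClosed_closure.isOpen_compl.inter isClosed_closure.isOpen_compl)).inter
        Metric.isOpen_ball).union ((isOpen_lt continuous_const continuous_norm).inter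
        (isClosed_closure.isOpen_compl.inter h'.isOpen))
    · refine Or.inl ⟨hcover z hz, ?_⟩
      rw [mem_ball_zero_iff]
      by_contra! hzr
      exact hz (hSr z (hr₀r.le.trans hzr))
    · have hev' : ∀ᶠ z : ℂ in Bornology.cobounded ℂ, r < ‖z‖ :=
        tendsto_norm_cobounded_atTop.eventually_gt_atTop r
      filter_upwards [hev, hev'] with z hz hz'
      exact Or.inr ⟨hz', hz⟩
    · rintro (l | l | l)
      exacts [h.continuousOn l, h'.continuousOn l, hcont.continuousOn]
    · rintro (l | l | l)
      exacts [h.intervalIntegrable l, (h'.intervalIntegrable l).neg,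
        (continuous_const.mul hcont).neg.intervalIntegrable _ _]
    · rintro (l | l | l) t ht
      exacts [hWS (h.mem_frontier l t ht), hWS' (h'.mem_frontier l t ht),
        hSr _ (hr₀r.le.trans (hnorm t).ge)]
    · rintro (l | l | l) t ht
      · have hf := h.mem_frontier l t ht
        rintro (⟨h1, -⟩ | ⟨-, h1, -⟩)
        exacts [notMem_inter_union_of_mem_frontier h.isOpen hf h1, h1 hf.1]
      · have hf := h'.mem_frontier l t ht
        rintro (⟨h1, -⟩ | ⟨-, -, h1⟩)
        · rw [inter_comm, inter_comm (closure W)ᶜ] at h1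
          exact notMem_inter_union_of_mem_frontier h'.isOpen hf h1
        · exact hf.2 (by rwa [h'.isOpen.interior_eq])
      · have := hnorm t
        rintro (⟨-, h1⟩ | ⟨h1, -⟩)
        · rw [mem_ball_zero_iff] at h1
          simp only [Sum.elim_inr] at h1
          linarith
        · change r < ‖circleMap 0 r (2 * Real.pi * t)‖ at h1
          linarith
    · intro z hz
      have hcirc : ∫ t in (0 : ℝ)..1, -(2 * Real.pi * Complex.I *
          circleMap 0 r (2 * Real.pi * t)) / (circleMap 0 r (2 * Real.pi * t) - z) =
          -∮ w in C(0, r), (w - z)⁻¹ := by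
        rw [circleIntegral_eq_intervalIntegral, ← intervalIntegral.integral_neg]
        simp only [smul_eq_mul, div_eq_mul_inv, neg_mul]
      simp only [Fintype.sum_sum_type, Sum.elim_inl, Sum.elim_inr, neg_div,
        intervalIntegral.integral_neg, Finset.sum_neg_distrib, Finset.univ_unique,
        Finset.sum_singleton] at hcirc ⊢
      rw [hcirc]
      rcases hz with ⟨⟨h1, h2⟩ | ⟨h1, h2⟩, h3⟩ | ⟨h3, h1, h2⟩
      · rw [circleIntegral.integral_sub_inv_of_mem_ball h3, h.index_inside z h1,
          h'.index_inside z h2, if_pos hW, if_neg hW']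
        ring
      · rw [circleIntegral.integral_sub_inv_of_mem_ball h3, h.index_outside z h1,
          h'.index_outside z h2, if_pos hW, if_neg hW']
        ring
      · rw [circleIntegral_sub_inv_of_norm_gt hr h3, h.index_outside z h1,
          h'.index_inside z h2, if_pos hW, if_neg hW']
        ring
  -- The difference of the two boundary integrals does not depend on `r`, so it suffices to bring
  -- the circle integral within `ε` of `c`. The integral of `z⁻¹ • c` gives `c` exactly, and the
  -- remainder is at most `ε / r` on a circle of length `2πr`.
  rw [← sub_eq_iff_eq_add, ← smul_sub, ← sub_eq_zero, ← norm_le_zero_iff]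
  refine le_of_forall_pos_le_add fun ε hε => ?_
  obtain ⟨r₁, -, hr₁⟩ := hasBasis_cobounded_norm.eventually_iff.1
    (Metric.tendsto_nhds.1 hc ε hε)
  obtain ⟨r, hr⟩ := exists_gt (max (max r₀ r₁) 0)
  simp only [max_lt_iff] at hr
  obtain ⟨⟨hr0, hr1⟩, hrpos⟩ := hr
  have hint : CircleIntegrable F 0 r := by
    refine ContinuousOn.circleIntegrable hrpos.le (hF.continuousOn.mono fun z hz => hSr z ?_)
    rw [mem_sphere_zero_iff_norm.1 hz]
    exact hr0.le
  have hne : ∀ z ∈ Metric.sphere (0 : ℂ) r, z ≠ 0 := fun z hz h0 => by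
    rw [h0, mem_sphere_zero_iff_norm, norm_zero] at hz
    exact hrpos.ne hz
  have hint' : CircleIntegrable (fun z : ℂ => (z - 0)⁻¹ • c) 0 r := by
    refine ContinuousOn.circleIntegrable hrpos.le fun z hz => ?_
    have := hne z hz
    exact ContinuousAt.continuousWithinAt (by
      refine ContinuousAt.smul (ContinuousAt.inv₀ (by fun_prop) (by simpa)) continuousAt_const)
  have hcc : (2 * Real.pi * Complex.I : ℂ)⁻¹ • ∮ z in C(0, r), (z - 0)⁻¹ • c = c := by
    rw [circleIntegral.integral_smul_const, circleIntegral.integral_sub_inv_of_mem_ball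
      (Metric.mem_ball_self hrpos), smul_smul, inv_mul_cancel₀ (by simp [Real.pi_ne_zero]),
      one_smul]
  rw [hcircle r hrpos hr0, add_sub_cancel_right]
  nth_rewrite 1 [← hcc]
  rw [← smul_sub, ← circleIntegral.integral_sub hint hint']
  have := circleIntegral.norm_two_pi_i_inv_smul_integral_le_of_norm_le_const
    (f := fun z => F z - (z - 0)⁻¹ • c) (c := 0) (C := ε / r) hrpos.le fun z hz => ?_
  · rwa [mul_div_cancel₀ _ hrpos.ne', ← zero_add ε] at this
  · have h0 := hne z hz
    have hz' := mem_sphere_zero_iff_norm.1 hz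
    have h1 := hr₁ (x := z) (by simpa [hz'] using hr1.le)
    have h2 : F z - (z - 0)⁻¹ • c = z⁻¹ • (z • F z - c) := by
      rw [smul_sub, inv_smul_smul₀ h0, sub_zero]
    rw [h2, norm_smul, norm_inv, hz', ← dist_eq_norm, inv_mul_eq_div]
    gcongr

end IsWeightedBoundary

end WeightedBoundary

/-! ### Resolvents on a complex Banach space and uniqueness of the Riesz-Dunford integral -/

section ComplexResolvent

open MeasureTheory

theorem IsBoundedInverse.unique {R E : Type*} [Ring R] [NormedAddCommGroup E] [Module R E]
    {A : E →ₗ.[R] E} {B B' : E →L[R] E} (h : IsBoundedInverse A B) (h' : IsBoundedInverse A B') :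
    B = B' := by
  ext v
  obtain ⟨hd, hv⟩ := h.1 v
  have := h'.2 ⟨B v, hd⟩
  rw [hv] at this
  exact this.symm

variable {E : Type*} [NormedAddCommGroup E] [NormedSpace ℂ E] {A : E →ₗ.[ℂ] E}

theorem isBoundedInverse_smul_sub_iff {z : ℂ} {B : E →L[ℂ] E} :
    IsBoundedInverse (z • opId ℂ E - A) B ↔
      (∀ v, ∃ h : B v ∈ A.domain, z • B v - A ⟨B v, h⟩ = v) ∧
        ∀ u : A.domain, B (z • (u : E) - A u) = u := by
  constructor
  · rintro ⟨h1, h2⟩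
    exact ⟨fun v => let ⟨h, hv⟩ := h1 v; ⟨h.2, hv⟩, fun u => h2 ⟨u, trivial, u.2⟩⟩
  · rintro ⟨h1, h2⟩
    exact ⟨fun v => let ⟨h, hv⟩ := h1 v; ⟨⟨trivial, h⟩, hv⟩, fun u => h2 ⟨u, u.2.2⟩⟩

theorem complexResolvent_eq {z : ℂ} {B : E →L[ℂ] E}
    (h : IsBoundedInverse (z • opId ℂ E - A) B) : complexResolvent A z = B := by
  have hex : ∃ B : E →L[ℂ] E, IsBoundedInverse (z • opId ℂ E - A) B := ⟨B, h⟩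
  rw [complexResolvent, dif_pos hex]
  exact hex.choose_spec.unique h

theorem isBoundedInverse_complexResolvent {z : ℂ} (h : z ∈ complexResolventSet A) :
    IsBoundedInverse (z • opId ℂ E - A) (complexResolvent A z) := by
  obtain ⟨B, hB⟩ := h
  rwa [complexResolvent_eq hB]

/-- The factorisation is `z - A = (1 + (z - z₀) B) (z₀ - A)`. As the first factor is a unit for `z`
near `z₀`, it yields openness of the resolvent set and holomorphy of the resolvent together. -/
theorem isBoundedInverse_mul_inverse {z₀ z : ℂ} {B : E →L[ℂ] E}
    (h : IsBoundedInverse (z₀ • opId ℂ E - A) B) (hu : IsUnit (1 + (z - z₀) • B)) :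
    IsBoundedInverse (z • opId ℂ E - A) (B * Ring.inverse (1 + (z - z₀) • B)) := by
  rw [isBoundedInverse_smul_sub_iff] at h ⊢
  obtain ⟨h1, h2⟩ := h
  set C := 1 + (z - z₀) • B with hC
  have hCv : ∀ v, C v = v + (z - z₀) • B v := fun v => rfl
  have hright : ∀ v, C (Ring.inverse C v) = v := fun v =>
    DFunLike.congr_fun (Ring.mul_inverse_cancel C hu) v
  have hleft : ∀ v, Ring.inverse C (C v) = v := fun v =>
    DFunLike.congr_fun (Ring.inverse_mul_cancel C hu) v
  constructor
  · intro v
    obtain ⟨hd, hv⟩ := h1 (Ring.inverse C v)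
    refine ⟨hd, ?_⟩
    have h3 := hright v
    rw [hCv] at h3
    change z • B (Ring.inverse C v) - A ⟨B (Ring.inverse C v), hd⟩ = v
    nth_rewrite 3 [← h3]
    nth_rewrite 3 [← hv]
    rw [sub_smul]
    abel
  · intro u
    have h3 := h2 u
    have h4 : z • (u : E) - A u = C (z₀ • (u : E) - A u) := by
      rw [hCv, h3, sub_smul]
      abel
    rw [h4]
    change B (Ring.inverse C (C _)) = _
    rw [hleft, h3]

variable [CompleteSpace E]

theorem eventually_isUnit_one_add_smul (B : E →L[ℂ] E) (z₀ : ℂ) :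
    ∀ᶠ z in 𝓝 z₀, IsUnit (1 + (z - z₀) • B) := by
  have hc : ContinuousAt (fun z : ℂ => 1 + (z - z₀) • B) z₀ := by fun_prop
  refine hc.eventually (Units.isOpen.eventually_mem ?_)
  simp

theorem isOpen_complexResolventSet : IsOpen (complexResolventSet A) := by
  refine isOpen_iff_mem_nhds.2 fun z₀ ⟨B, hB⟩ => ?_
  filter_upwards [eventually_isUnit_one_add_smul B z₀] with z hz
  exact ⟨_, isBoundedInverse_mul_inverse hB hz⟩

theorem differentiableOn_complexResolvent :
    DifferentiableOn ℂ (complexResolvent A) (complexResolventSet A) := by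
  rintro z₀ ⟨B, hB⟩
  have hd : DifferentiableAt ℂ (fun z : ℂ => B * Ring.inverse (1 + (z - z₀) • B)) z₀ := by
    refine DifferentiableAt.const_mul ?_ B
    have hinv : DifferentiableAt ℂ Ring.inverse (1 + (z₀ - z₀) • B) :=
      differentiableAt_inverse (by simp)
    exact hinv.comp (f := fun z : ℂ => 1 + (z - z₀) • B) z₀ (by fun_prop)
  refine (hd.congr_of_eventuallyEq ?_).differentiableWithinAt
  filter_upwards [eventually_isUnit_one_add_smul B z₀] with z hz
  exact complexResolvent_eq (isBoundedInverse_mul_inverse hB hz)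

omit [CompleteSpace E] in
/-- The resolvent of a bounded operator behaves like `z⁻¹` at infinity. -/
theorem tendsto_smul_complexResolvent (hA : IsBoundedOperator A)
    (hρ : ∀ᶠ z in Bornology.cobounded ℂ, z ∈ complexResolventSet A) :
    Tendsto (fun z => z • complexResolvent A z) (Bornology.cobounded ℂ) (𝓝 1) := by
  obtain ⟨hdom, C, hC⟩ := hA
  have hlim : Tendsto (fun z : ℂ => |C| * (‖z‖ - |C|)⁻¹) (Bornology.cobounded ℂ) (𝓝 0) := by
    have h1 : Tendsto (fun z : ℂ => ‖z‖ - |C|) (Bornology.cobounded ℂ) atTop :=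
      tendsto_atTop_add_const_right _ _ tendsto_norm_cobounded_atTop
    simpa using h1.inv_tendsto_atTop.const_mul |C|
  have hgt : ∀ᶠ z : ℂ in Bornology.cobounded ℂ, |C| < ‖z‖ :=
    tendsto_norm_cobounded_atTop.eventually_gt_atTop _
  rw [tendsto_iff_norm_sub_tendsto_zero]
  refine squeeze_zero' (Eventually.of_forall fun _ => norm_nonneg _) ?_ hlim
  filter_upwards [hρ, hgt] with z hz hzC
  have h0 : 0 < ‖z‖ - |C| := by linarith
  obtain ⟨h1, -⟩ := isBoundedInverse_smul_sub_iff.1 (isBoundedInverse_complexResolvent hz)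
  -- Since `z R - 1 = A R`, it is enough that `R` tends to zero; the same identity bounds its norm
  -- by `(‖z‖ - |C|)⁻¹`.
  set R := complexResolvent A z
  have hAR : ∀ v, ‖z • R v - v‖ ≤ |C| * ‖R v‖ := fun v => by
    obtain ⟨hd, hv⟩ := h1 v
    nth_rewrite 2 [← hv]
    rw [sub_sub_cancel]
    exact (hC _).trans (by gcongr; exact le_abs_self C)
  have hR : ∀ v, ‖R v‖ ≤ (‖z‖ - |C|)⁻¹ * ‖v‖ := fun v => by
    rw [inv_mul_eq_div, le_div_iff₀ h0]
    have := norm_le_norm_add_norm_sub' (z • R v) v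
    rw [norm_smul] at this
    linarith [hAR v]
  refine ContinuousLinearMap.opNorm_le_bound _ (by positivity) fun v => ?_
  calc ‖z • R v - v‖ ≤ |C| * ‖R v‖ := hAR v
    _ ≤ |C| * ((‖z‖ - |C|)⁻¹ * ‖v‖) := by gcongr; exact hR v
    _ = _ := by ring

/-- The boundary integrals of the Riesz-Dunford functional calculus do not depend on the domain and
on the parametrization of its boundary. -/
theorem rieszDunford_integral_unique {ι ι' : Type*} [Fintype ι] [Fintype ι'] {γ ρ : ι → ℝ → ℂ}
    {γ' ρ' : ι' → ℝ → ℂ} {W W' : Set ℂ} {g : ℂ → ℂ} {D : Set ℂ} {c c' : ℂ}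
    (h : IsWeightedBoundary γ ρ W) (h' : IsWeightedBoundary γ' ρ' W')
    (hD : IsOpen D) (hg : DifferentiableOn ℂ g D)
    (hσ : (complexResolventSet A)ᶜ ⊆ W) (hσ' : (complexResolventSet A)ᶜ ⊆ W')
    (hWD : closure W ⊆ D) (hWD' : closure W' ⊆ D)
    (hW : (¬ Bornology.IsBounded W ∧ HasValueAtInfinity g D c) ∨
      (IsBoundedOperator A ∧ Bornology.IsBounded W ∧ c = 0))
    (hW' : (¬ Bornology.IsBounded W' ∧ HasValueAtInfinity g D c') ∨
      (IsBoundedOperator A ∧ Bornology.IsBounded W' ∧ c' = 0)) :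
    c • (1 : E →L[ℂ] E) + (2 * Real.pi * Complex.I : ℂ)⁻¹ •
        ∑ l, ∫ t in (0 : ℝ)..1, (ρ l t * g (γ l t)) • complexResolvent A (γ l t) =
      c' • (1 : E →L[ℂ] E) + (2 * Real.pi * Complex.I : ℂ)⁻¹ •
        ∑ l, ∫ t in (0 : ℝ)..1, (ρ' l t * g (γ' l t)) • complexResolvent A (γ' l t) := by
  simp only [mul_smul]
  have hS : IsOpen (D ∩ complexResolventSet A) := hD.inter isOpen_complexResolventSet
  have hF : DifferentiableOn ℂ (fun z => g z • complexResolvent A z)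
      (D ∩ complexResolventSet A) :=
    (hg.mono inter_subset_left).smul (differentiableOn_complexResolvent.mono inter_subset_right)
  have hfr : ∀ {X : Set ℂ}, IsOpen X → (complexResolventSet A)ᶜ ⊆ X → closure X ⊆ D →
      frontier X ⊆ D ∩ complexResolventSet A := fun hX hσX hXD z hz => by
    refine ⟨hXD hz.1, ?_⟩
    by_contra hzσ
    exact hz.2 (by rw [hX.interior_eq]; exact hσX hzσ)
  -- A point where the integrand is not holomorphic is either spectral, hence in both domains, or
  -- outside `D`, hence outside both closures.
  have hcover : ∀ z ∉ D ∩ complexResolventSet A,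
      z ∈ W ∩ W' ∪ (closure W)ᶜ ∩ (closure W')ᶜ := fun z hz => by
    by_cases hzD : z ∈ D
    · have hzσ : z ∈ (complexResolventSet A)ᶜ := fun h => hz ⟨hzD, h⟩
      exact Or.inl ⟨hσ hzσ, hσ' hzσ⟩
    · exact Or.inr ⟨fun h => hzD (hWD h), fun h => hzD (hWD' h)⟩
  -- As the resolvent of a bounded operator behaves like `z⁻¹`, the large circle contributes
  -- precisely the term `g(∞) I` that the unbounded domain carries.
  have hlim : ∀ {X : Set ℂ} {b : ℂ}, IsBoundedOperator A → Bornology.IsBounded X →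
      (complexResolventSet A)ᶜ ⊆ X → HasValueAtInfinity g D b →
      Tendsto (fun z => z • g z • complexResolvent A z) (Bornology.cobounded ℂ)
        (𝓝 (b • (1 : E →L[ℂ] E))) := fun hA hX hσX hb => by
    have hev : ∀ᶠ z in Bornology.cobounded ℂ, z ∈ complexResolventSet A := by
      have : ∀ᶠ z in Bornology.cobounded ℂ, z ∉ _ := hX.subset hσX
      simpa using this
    simp only [smul_comm _ (g _)]
    exact hb.2.smul (tendsto_smul_complexResolvent hA hev)
  have hWf := hfr h.isOpen hσ hWD
  have hWf' := hfr h'.isOpen hσ' hWD'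
  rcases hW with ⟨hW, hc⟩ | ⟨hA, hW, rfl⟩ <;> rcases hW' with ⟨hW', hc'⟩ | ⟨hA', hW', rfl⟩
  · rw [tendsto_nhds_unique hc.2 hc'.2,
      h.sum_integral_eq h' (iff_of_false hW hW') hS hWf hWf' hcover hF]
  · rw [zero_smul, zero_add]
    refine (h'.sum_integral_eq_add h hW' hW hS hWf' hWf (fun z hz => ?_) hF
      (hlim hA' hW' hσ' hc)).symm
    rw [inter_comm W', inter_comm (closure W')ᶜ]
    exact hcover z hz
  · rw [zero_smul, zero_add]
    exact h.sum_integral_eq_add h' hW hW' hS hWf hWf' hcover hF (hlim hA hW hσ hc')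
  · rw [h.sum_integral_eq h' (iff_of_true hW hW') hS hWf hWf' hcover hF]

end ComplexResolvent

/-! ### Piecewise smooth boundaries and their reflections -/

section PositiveBoundary

open MeasureTheory

/-- On each open piece `deriv γ` is the continuous one-sided derivative of the closed piece; its
values at the finitely many partition points do not matter. -/
theorem IsPiecewiseC1JordanCurve.intervalIntegrable_deriv {γ : ℝ → ℂ}
    (h : IsPiecewiseC1JordanCurve γ) : IntervalIntegrable (deriv γ) volume 0 1 := by
  obtain ⟨-, -, -, n, t, ht, ht0, ht1, hγ⟩ := h
  rw [intervalIntegrable_iff_integrableOn_Icc_of_le zero_le_one]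
  have hcover : Icc (0 : ℝ) 1 ⊆ {1} ∪ ⋃ k : Fin n, Icc (t k.castSucc) (t k.succ) := by
    intro x hx
    by_cases hx1 : x = 1
    · exact Or.inl hx1
    right
    -- The induction looks for the first partition point strictly above `x`; as there is none for `x
    -- = 1`, this point is covered separately.
    have key : ∀ m : Fin (n + 1), x < t m →
        x ∈ ⋃ k : Fin n, Icc (t k.castSucc) (t k.succ) := by
      intro m
      induction m using Fin.induction with
      | zero => intro h; rw [ht0] at h; exact absurd hx.1 (not_le.2 h)
      | succ k ih =>
        intro h
        by_cases hk : x < t k.castSucc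
        · exact ih hk
        · exact mem_iUnion.2 ⟨k, not_lt.1 hk, h.le⟩
    exact key (Fin.last n) (by rw [ht1]; exact lt_of_le_of_ne hx.2 hx1)
  refine IntegrableOn.mono_set ?_ hcover
  refine IntegrableOn.union (by simp) ((integrableOn_finite_iUnion).2 fun k => ?_)
  have hlt : t k.castSucc < t k.succ := ht k.castSucc_lt_succ
  rw [integrableOn_Icc_iff_integrableOn_Ioo]
  have hc : ContinuousOn (derivWithin γ (Icc (t k.castSucc) (t k.succ)))
      (Icc (t k.castSucc) (t k.succ)) :=
    (hγ k).continuousOn_derivWithin (uniqueDiffOn_Icc hlt) le_rfl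
  refine (hc.integrableOn_Icc.mono_set Ioo_subset_Icc_self).congr_fun (fun x hx => ?_)
    measurableSet_Ioo
  exact derivWithin_of_mem_nhds (Icc_mem_nhds hx.1 hx.2)

theorem IsPositiveBoundary.isWeightedBoundary {n : ℕ} {γ : Fin n → ℝ → ℂ} {W : Set ℂ}
    (hW : IsOpen W) (h : IsPositiveBoundary γ W) :
    IsWeightedBoundary γ (fun l => deriv (γ l)) W where
  isOpen := hW
  isBounded_frontier := by
    rw [← h.boundary.2.2]
    exact (isCompact_iUnion fun l =>
      isCompact_Icc.image_of_continuousOn (h.boundary.2.1 l).1).isBounded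
  continuousOn l := (h.boundary.2.1 l).1
  intervalIntegrable l := (h.boundary.2.1 l).intervalIntegrable_deriv
  mem_frontier l t ht := by
    rw [← h.boundary.2.2]
    exact mem_iUnion.2 ⟨l, mem_image_of_mem _ ht⟩
  index_inside z hz := by
    have := h.index_inside z hz
    rw [totalIndex, inv_mul_eq_iff_eq_mul₀ (by simp [Real.pi_ne_zero])] at this
    simpa [curvesIntegral] using this
  index_outside z hz := by
    have := h.index_outside z hz
    rw [totalIndex, inv_mul_eq_iff_eq_mul₀ (by simp [Real.pi_ne_zero])] at this
    simpa [curvesIntegral] using this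

/-- Reflection reverses the orientation and the sign of the weights restores it: the index integral
at `z` becomes minus the conjugate of the one at the conjugate point, and `2πi` is invariant under
this operation. -/
theorem IsWeightedBoundary.conj {ι : Type*} [Fintype ι] {γ ρ : ι → ℝ → ℂ} {W : Set ℂ}
    (h : IsWeightedBoundary γ ρ W) (hW : ∀ z ∈ W, (starRingEnd ℂ) z ∈ W) :
    IsWeightedBoundary (fun l t => (starRingEnd ℂ) (γ l t))
      (fun l t => -(starRingEnd ℂ) (ρ l t)) W := by
  have hpre : Complex.conjCLE ⁻¹' W = W := by
    ext z
    refine ⟨fun hz => ?_, fun hz => hW z hz⟩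
    have := hW _ hz
    simpa using this
  have hfr : ∀ z ∈ frontier W, (starRingEnd ℂ) z ∈ frontier W := fun z hz => by
    have heq := Complex.conjCLE.toHomeomorph.preimage_frontier W
    change _ = frontier (Complex.conjCLE ⁻¹' W) at heq
    rw [hpre] at heq
    rw [← heq] at hz
    exact hz
  have hcl : ∀ z ∉ closure W, (starRingEnd ℂ) z ∉ closure W := fun z hz => by
    have heq := Complex.conjCLE.toHomeomorph.preimage_closure W
    change _ = closure (Complex.conjCLE ⁻¹' W) at heq
    rw [hpre] at heq
    rw [← heq] at hz
    exact hz
  have hint : ∀ z, ∑ l, ∫ t in (0 : ℝ)..1,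
      -(starRingEnd ℂ) (ρ l t) / ((starRingEnd ℂ) (γ l t) - z) =
        -(starRingEnd ℂ) (∑ l, ∫ t in (0 : ℝ)..1, ρ l t / (γ l t - (starRingEnd ℂ) z)) := by
    intro z
    rw [map_sum, ← Finset.sum_neg_distrib]
    refine Finset.sum_congr rfl fun l _ => ?_
    rw [intervalIntegral.integral_of_le zero_le_one, intervalIntegral.integral_of_le zero_le_one,
      ← integral_conj, ← integral_neg]
    simp [neg_div]
  refine ⟨h.isOpen, h.isBounded_frontier, fun l => ?_, fun l => ?_,
    fun l t ht => hfr _ (h.mem_frontier l t ht), fun z hz => ?_, fun z hz => ?_⟩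
  · exact Complex.continuous_conj.comp_continuousOn (h.continuousOn l)
  · have := h.intervalIntegrable l
    rw [intervalIntegrable_iff] at this ⊢
    exact (Complex.conjCLE.toContinuousLinearMap.integrable_comp this).neg
  · rw [hint, h.index_inside _ (hW z hz)]
    split_ifs <;> simp [map_ofNat (starRingEnd ℂ) 2]
  · rw [hint, h.index_outside _ (hcl z hz)]
    split_ifs <;> simp [map_ofNat (starRingEnd ℂ) 2]

end PositiveBoundary

/-! ### Complex planes and axially symmetric sets -/

section Plane

theorem planeHom_I (i : ImagUnit) : planeHom i Complex.I = i.1 := by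
  simp [planeHom]

theorem re_planeHom (i : ImagUnit) (z : ℂ) : (planeHom i z).re = z.re := by
  rw [planeHom_apply, Quaternion.mul_coe_eq_smul]
  simp [i.2.1]

theorem planeHom_ofReal (i : ImagUnit) (r : ℝ) : planeHom i (r : ℂ) = (r : ℍ) := by
  simp

theorem planeHom_conj (i : ImagUnit) (z : ℂ) :
    planeHom i ((starRingEnd ℂ) z) = star (planeHom i z) := by
  have hs : star i.1 = -i.1 := QuaternionAlgebra.star_eq_neg.2 i.2.1
  rw [planeHom_apply, planeHom_apply, Quaternion.mul_coe_eq_smul, Quaternion.mul_coe_eq_smul]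
  simp [hs]

theorem norm_im_planeHom (i : ImagUnit) (z : ℂ) : ‖(planeHom i z).im‖ = |z.im| := by
  have h : (planeHom i z).im = z.im • i.1 := by
    rw [planeHom_apply, Quaternion.mul_coe_eq_smul]
    have : i.1.im = i.1 := by
      ext <;> simp [i.2.1]
    simp [this]
  rw [h, norm_smul, i.2.2, mul_one, Real.norm_eq_abs]

theorem continuous_planeHom (i : ImagUnit) : Continuous (planeHom i) :=
  (AddMonoidHomClass.isometry_of_norm (planeHom i) (norm_planeHom i)).continuous

theorem continuous_planeCoord (i : ImagUnit) : Continuous (planeCoord i) := by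
  have h : planeCoord i = fun q => (q.re : ℂ) + (-(q * i.1).re : ℝ) * Complex.I := by
    ext q
    apply Complex.ext <;> simp [planeCoord]
  rw [h]
  have := Quaternion.continuous_re
  have h2 : Continuous fun q : ℍ => (q * i.1).re := this.comp (by fun_prop)
  fun_prop

/-- The imaginary unit `-i`. -/
def ImagUnit.neg (i : ImagUnit) : ImagUnit := ⟨-i.1, by simp [i.2.1], by simp [i.2.2]⟩

/-- Spheres are described by a nonnegative imaginary coordinate; a negative one is absorbed by
passing from `j` to `-j`. -/
theorem planeHom_mem_sphereOf (i j : ImagUnit) {z w : ℂ} (hre : w.re = z.re)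
    (him : |w.im| = |z.im|) : planeHom j w ∈ sphereOf (planeHom i z) := by
  change ∃ k : ImagUnit, _
  rw [re_planeHom, norm_im_planeHom, ← him, ← hre]
  rcases abs_cases w.im with ⟨h, -⟩ | ⟨h, -⟩
  · exact ⟨j, by rw [h, planeHom_apply]⟩
  · exact ⟨j.neg, by rw [h, planeHom_apply]; simp [ImagUnit.neg]⟩

/-- A nonreal quaternion determines the unit by its normalized imaginary part; a real one lies in
every plane, and there `i` is taken. -/
theorem exists_planeHom_eq (i : ImagUnit) (q : ℍ) : ∃ (j : ImagUnit) (z : ℂ), planeHom j z = q := by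
  by_cases h : q.im = 0
  · refine ⟨i, (q.re : ℂ), ?_⟩
    rw [planeHom_ofReal]
    nth_rewrite 2 [← Quaternion.re_add_im q]
    simp [h]
  · have h0 : ‖q.im‖ ≠ 0 := norm_ne_zero_iff.2 h
    have h1 : ‖‖q.im‖⁻¹ • q.im‖ = 1 := by
      rw [norm_smul, norm_inv, norm_norm, inv_mul_cancel₀ h0]
    refine ⟨⟨‖q.im‖⁻¹ • q.im, by simp, h1⟩, ⟨q.re, ‖q.im‖⟩, (planeHom_apply _ _).trans ?_⟩
    rw [Quaternion.mul_coe_eq_smul]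
    change (q.re : ℍ) + ‖q.im‖ • ‖q.im‖⁻¹ • q.im = q
    rw [smul_smul, mul_inv_cancel₀ h0, one_smul, Quaternion.re_add_im]

namespace IsAxiallySymmetric

variable {U : Set ℍ}

theorem planeHom_mem (hU : IsAxiallySymmetric U) {i : ImagUnit} (j : ImagUnit) {z w : ℂ}
    (hre : w.re = z.re) (him : |w.im| = |z.im|) (hz : planeHom i z ∈ U) : planeHom j w ∈ U :=
  hU _ hz (planeHom_mem_sphereOf i j hre him)

theorem slice_eq (hU : IsAxiallySymmetric U) (i j : ImagUnit) : slice i U = slice j U :=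
  Subset.antisymm (fun _ hz => hU.planeHom_mem j rfl rfl hz)
    fun _ hz => hU.planeHom_mem i rfl rfl hz

theorem conj_mem_slice (hU : IsAxiallySymmetric U) {i : ImagUnit} {z : ℂ} (hz : z ∈ slice i U) :
    (starRingEnd ℂ) z ∈ slice i U :=
  hU.planeHom_mem i (by simp) (by simp) hz

theorem isBounded_slice_iff (hU : IsAxiallySymmetric U) (i : ImagUnit) :
    Bornology.IsBounded (slice i U) ↔ Bornology.IsBounded U := by
  simp only [isBounded_iff_forall_norm_le]
  constructor
  · rintro ⟨C, hC⟩
    refine ⟨C, fun q hq => ?_⟩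
    obtain ⟨j, z, rfl⟩ := exists_planeHom_eq i q
    rw [norm_planeHom]
    exact hC z (hU.planeHom_mem i rfl rfl hq)
  · rintro ⟨C, hC⟩
    exact ⟨C, fun z hz => norm_planeHom i z ▸ hC _ hz⟩

end IsAxiallySymmetric

theorem closure_slice_subset (i : ImagUnit) (U : Set ℍ) :
    closure (slice i U) ⊆ slice i (closure U) :=
  (continuous_planeHom i).closure_preimage_subset U

end Plane

/-! ### Intrinsic functions as holomorphic functions on the planes -/

section Intrinsic

namespace IsIntrinsicSliceHyperholomorphic

variable {f : ℍ → ℍ} {D : Set ℍ}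

/-- On every plane `ℂ_i` an intrinsic function is given by the same holomorphic function, which
commutes with the conjugation. -/
theorem exists_holomorphic (hf : IsIntrinsicSliceHyperholomorphic f D) : ∃ g : ℂ → ℂ,
    ∀ i : ImagUnit, DifferentiableOn ℂ g (slice i D) ∧
      (∀ z ∈ slice i D, f (planeHom i z) = planeHom i (g z)) ∧
      ∀ z ∈ slice i D, g ((starRingEnd ℂ) z) = (starRingEnd ℂ) (g z) := by
  obtain ⟨α, β, h⟩ := hf.exists_components
  refine ⟨fun z => (α (z.re, z.im) : ℂ) + (β (z.re, z.im) : ℂ) * Complex.I, fun i => ?_⟩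
  have h' : ∀ z ∈ slice i D, _ := fun z hz =>
    h i z.re z.im (by rw [← planeHom_apply]; exact hz)
  refine ⟨fun z hz => ?_, fun z hz => ?_, fun z hz => ?_⟩
  · obtain ⟨-, -, -, hα, hβ, h1, h2⟩ := h' z hz
    refine DifferentiableAt.differentiableWithinAt ?_
    let e : ℂ →L[ℝ] ℝ × ℝ := Complex.reCLM.prod Complex.imCLM
    have hα' : HasFDerivAt (fun z : ℂ => α (z.re, z.im))
        ((fderiv ℝ α (z.re, z.im)).comp e) z :=
      hα.hasFDerivAt.comp z (f := fun z : ℂ => (z.re, z.im)) e.hasFDerivAt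
    have hβ' : HasFDerivAt (fun z : ℂ => β (z.re, z.im))
        ((fderiv ℝ β (z.re, z.im)).comp e) z :=
      hβ.hasFDerivAt.comp z (f := fun z : ℂ => (z.re, z.im)) e.hasFDerivAt
    have hg := (Complex.ofRealCLM.hasFDerivAt.comp z hα').add
      ((Complex.ofRealCLM.hasFDerivAt.comp z hβ').mul_const Complex.I)
    -- The Cauchy-Riemann equations enter in the form that the derivative in direction `I` is `I`
    -- times the one in direction `1`.
    refine differentiableAt_complex_iff_differentiableAt_real.2 ⟨hg.differentiableAt, ?_⟩
    change fderiv ℝ ((Complex.ofRealCLM ∘ fun z : ℂ => α (z.re, z.im)) +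
      fun z => (Complex.ofRealCLM ∘ fun z : ℂ => β (z.re, z.im)) z * Complex.I) z Complex.I = _ •
        fderiv ℝ ((Complex.ofRealCLM ∘ fun z : ℂ => α (z.re, z.im)) +
      fun z => (Complex.ofRealCLM ∘ fun z : ℂ => β (z.re, z.im)) z * Complex.I) z 1
    rw [hg.fderiv]
    apply Complex.ext <;> simp [e, h1, h2]
  · rw [planeHom_apply i z, (h' z hz).1, map_add, map_mul, planeHom_ofReal, planeHom_ofReal,
      planeHom_I, Quaternion.coe_commutes]
  · obtain ⟨-, h1, h2, -⟩ := h' z hz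
    apply Complex.ext <;> simp [h1, h2]

theorem sliceFunction_eq {i : ImagUnit} {g : ℂ → ℂ} {z : ℂ}
    (h : f (planeHom i z) = planeHom i (g z)) : sliceFunction i f z = g z := by
  rw [sliceFunction, h, planeCoord_planeHom]

theorem planeHom_sliceFunction (hf : IsIntrinsicSliceHyperholomorphic f D) {i : ImagUnit} {z : ℂ}
    (hz : z ∈ slice i D) : planeHom i (sliceFunction i f z) = f (planeHom i z) := by
  obtain ⟨g, hg⟩ := hf.exists_holomorphic
  rw [sliceFunction_eq ((hg i).2.1 z hz), (hg i).2.1 z hz]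

theorem differentiableOn_sliceFunction (hf : IsIntrinsicSliceHyperholomorphic f D)
    (i : ImagUnit) : DifferentiableOn ℂ (sliceFunction i f) (slice i D) := by
  obtain ⟨g, hg⟩ := hf.exists_holomorphic
  exact (hg i).1.congr fun z hz => sliceFunction_eq ((hg i).2.1 z hz)

theorem sliceFunction_conj (hf : IsIntrinsicSliceHyperholomorphic f D) {i : ImagUnit} {z : ℂ}
    (hz : z ∈ slice i D) :
    sliceFunction i f ((starRingEnd ℂ) z) = (starRingEnd ℂ) (sliceFunction i f z) := by
  obtain ⟨g, hg⟩ := hf.exists_holomorphic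
  have hz' := hf.axiallySymmetric.conj_mem_slice hz
  rw [sliceFunction_eq ((hg i).2.1 z hz), sliceFunction_eq ((hg i).2.1 _ hz'), (hg i).2.2 z hz]

theorem sliceFunction_congr (hf : IsIntrinsicSliceHyperholomorphic f D) (i j : ImagUnit) {z : ℂ}
    (hz : z ∈ slice i D) : sliceFunction i f z = sliceFunction j f z := by
  obtain ⟨g, hg⟩ := hf.exists_holomorphic
  have hz' : z ∈ slice j D := by rwa [hf.axiallySymmetric.slice_eq j i]
  rw [sliceFunction_eq ((hg i).2.1 z hz), sliceFunction_eq ((hg j).2.1 _ hz')]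

theorem hasValueAtInfinity_sliceFunction (i : ImagUnit) {c : ℍ} (hc : HasValueAtInfinity f D c) :
    HasValueAtInfinity (sliceFunction i f) (slice i D) (planeCoord i c) := by
  obtain ⟨⟨r, hr, hrD⟩, hlim⟩ := hc
  refine ⟨⟨r, hr, fun z hz => hrD ?_⟩, ?_⟩
  · simpa [norm_planeHom] using hz
  · have hcob : Tendsto (planeHom i) (Bornology.cobounded ℂ) (Bornology.cobounded ℍ) := by
      rw [← tendsto_norm_atTop_iff_cobounded]
      simpa only [norm_planeHom] using tendsto_norm_cobounded_atTop
    exact ((continuous_planeCoord i).tendsto c).comp (hlim.comp hcob)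

/-- Commuting with conjugation, `f` is real on the real axis, and the limit may be taken along this
axis. As a consequence every left multiplication acts by `c` in the same way. -/
theorem value_at_infinity_real (hf : IsIntrinsicSliceHyperholomorphic f D) (i : ImagUnit) {c : ℍ}
    (hc : HasValueAtInfinity f D c) : c = (c.re : ℍ) := by
  obtain ⟨⟨r, hr, hrD⟩, hlim⟩ := hc
  have hcob : Tendsto (fun x : ℝ => (x : ℍ)) atTop (Bornology.cobounded ℍ) := by
    rw [← tendsto_norm_atTop_iff_cobounded]
    simpa only [Quaternion.norm_coe] using tendsto_norm_atTop_atTop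
  have him : c.im = 0 := by
    refine tendsto_nhds_unique ((Quaternion.continuous_im.tendsto c).comp (hlim.comp hcob))
      (tendsto_const_nhds.congr' ?_)
    filter_upwards [eventually_ge_atTop r] with x hx
    have hx' : (x : ℂ) ∈ slice i D := by
      refine hrD ?_
      simpa [norm_planeHom] using hx.trans (le_abs_self x)
    have h1 := hf.sliceFunction_conj hx'
    rw [Complex.conj_ofReal, eq_comm, Complex.conj_eq_iff_real] at h1
    obtain ⟨y, hy⟩ := h1
    have h2 := hf.planeHom_sliceFunction hx'
    rw [hy, planeHom_ofReal, planeHom_ofReal] at h2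
    simp [← h2]
  nth_rewrite 1 [← Quaternion.re_add_im c]
  rw [him, add_zero]

end IsIntrinsicSliceHyperholomorphic

end Intrinsic

/-! ### The resolvent of `T` on `V_i` -/

section SliceOperator

open MeasureTheory

variable {V : Type*} [NormedAddCommGroup V] [NormedSpace ℝ V] [CompleteSpace V]
  [Module ℍᵐᵒᵖ V] [IsScalarTower ℝ ℍᵐᵒᵖ V] [NormSMulClass ℍᵐᵒᵖ V] {T : ClosedRightOperator V}

/-- `Q_s(T)` sees only the real part and the modulus of `s`, so it is constant on spheres. Both the
reflection argument and the independence of the imaginary unit use this. -/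
theorem pseudoResolvent_congr {s s' : ℍ} (hre : s.re = s'.re) (hn : ‖s‖ = ‖s'‖) :
    pseudoResolvent T s = pseudoResolvent T s' := by
  have h : quadOp T s = quadOp T s' := by rw [quadOp, quadOp, hre, hn]
  rw [pseudoResolvent, h, ← pseudoResolvent]

theorem opPseudoResolvent_apply (s : ℍ) (v : V) :
    opPseudoResolvent T s v = T.op ⟨pseudoResolvent T s v, pseudoResolvent_mem T s v⟩ := rfl

theorem opPseudoResolvent_congr {s s' : ℍ} (hre : s.re = s'.re) (hn : ‖s‖ = ‖s'‖) :
    opPseudoResolvent T s = opPseudoResolvent T s' := by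
  ext v
  simp only [opPseudoResolvent_apply, pseudoResolvent_congr hre hn]

theorem isBoundedInverse_pseudoResolvent {s : ℍ} (hs : s ∈ sResolventSet T) :
    IsBoundedInverse (quadOp T s) (pseudoResolvent T s) := by
  have hs' : ∃ B : V →L[ℍᵐᵒᵖ] V, IsBoundedInverse (quadOp T s) B := hs
  rw [pseudoResolvent, dif_pos hs']
  exact hs'.choose_spec

theorem mem_opSq_domain {v : V} :
    v ∈ (opSq T.op).domain ↔ ∃ h : v ∈ T.op.domain, T.op ⟨v, h⟩ ∈ T.op.domain := by
  constructor
  · rintro ⟨⟨⟨y, hy⟩, hy', rfl⟩, hd⟩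
    exact ⟨hy, hy'⟩
  · rintro ⟨h, h'⟩
    exact ⟨⟨⟨v, h⟩, h', rfl⟩, h⟩

theorem pseudoResolvent_spec {s : ℍ} (hs : s ∈ sResolventSet T) (v : V) :
    ∃ h : opPseudoResolvent T s v ∈ T.op.domain,
      T.op ⟨opPseudoResolvent T s v, h⟩ - (2 * s.re) • opPseudoResolvent T s v +
        ‖s‖ ^ 2 • pseudoResolvent T s v = v := by
  obtain ⟨hd, hv⟩ := (isBoundedInverse_pseudoResolvent hs).1 v
  obtain ⟨h1, h2⟩ := mem_opSq_domain.1 hd.1.1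
  exact ⟨h2, hv⟩

theorem pseudoResolvent_quadOp {s : ℍ} (hs : s ∈ sResolventSet T) {u : V} (hu : u ∈ T.op.domain)
    (hTu : T.op ⟨u, hu⟩ ∈ T.op.domain) :
    pseudoResolvent T s (T.op ⟨T.op ⟨u, hu⟩, hTu⟩ - (2 * s.re) • T.op ⟨u, hu⟩ + ‖s‖ ^ 2 • u) =
      u :=
  (isBoundedInverse_pseudoResolvent hs).2
    ⟨u, ⟨mem_opSq_domain.2 ⟨hu, hTu⟩, hu⟩, trivial⟩

theorem coe_real_smul_right (r : ℝ) (v : V) : v <• (r : ℍ) = r • v := by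
  have h : MulOpposite.op (r : ℍ) = algebraMap ℝ ℍᵐᵒᵖ r := rfl
  rw [h, algebraMap_smul]

theorem right_smul_smul (v : V) (a b : ℍ) : v <• a <• b = v <• (a * b) := by
  rw [smul_smul, ← MulOpposite.op_mul]

variable (i : ImagUnit)

theorem smul_toSlice (z : ℂ) (v : V) : z • toSlice i v = toSlice i (v <• planeHom i z) := rfl

theorem real_smul_toSlice (r : ℝ) (v : V) : r • toSlice i v = toSlice i (r • v) := by
  rw [← coe_real_smul_right r v, ← planeHom_ofReal i, ← smul_toSlice, Complex.coe_smul]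

theorem right_smul_planeHom (v : V) (z : ℂ) :
    v <• planeHom i z = z.re • v + z.im • v <• i.1 := by
  rw [planeHom_apply, MulOpposite.op_add, add_smul, coe_real_smul_right, ← Quaternion.coe_commutes,
    ← right_smul_smul, coe_real_smul_right, smul_comm]

theorem norm_right_smul (v : V) (a : ℍ) : ‖v <• a‖ = ‖a‖ * ‖v‖ := by
  rw [norm_smul, MulOpposite.norm_op]

/-- A bounded operator on the complex Banach space `V_i`, seen as an operator on `V`. -/
def ofSliceOp : (SliceSpace i V →L[ℂ] SliceSpace i V) →L[ℝ] (V →L[ℝ] V) :=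
  LinearMap.mkContinuous
    { toFun := fun B => LinearMap.mkContinuous
        { toFun := fun v => (toSlice i).symm (B (toSlice i v))
          map_add' := fun v w => by simp
          map_smul' := fun r v => by
            rw [← real_smul_toSlice, ← Complex.coe_smul r (toSlice i v), map_smul, Complex.coe_smul]
            exact (toSlice i).symm_apply_eq.2 (real_smul_toSlice (V := V) i _ _) } ‖B‖
        fun v => B.le_opNorm (toSlice i v)
      map_add' := fun B C => rfl
      map_smul' := fun r B => by
        ext v
        exact (toSlice i).symm_apply_eq.2 (real_smul_toSlice (V := V) i _ _) } 1 fun B => by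
    rw [one_mul]
    exact ContinuousLinearMap.opNorm_le_bound _ (norm_nonneg B) fun v => B.le_opNorm (toSlice i v)

theorem toSlice_ofSliceOp (B : SliceSpace i V →L[ℂ] SliceSpace i V) (v : V) :
    toSlice i (ofSliceOp i B v) = B (toSlice i v) := rfl

theorem ofSliceOp_smul (z : ℂ) (B : SliceSpace i V →L[ℂ] SliceSpace i V) (v : V) :
    ofSliceOp i (z • B) v = ofSliceOp i B v <• planeHom i z := rfl

variable {i}

theorem pseudoResolvent_right_smul (s a : ℍ) (v : V) :
    pseudoResolvent T s (v <• a) = pseudoResolvent T s v <• a :=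
  (pseudoResolvent T s).map_smul _ _

theorem opPseudoResolvent_right_smul (s a : ℍ) (v : V) :
    opPseudoResolvent T s (v <• a) = opPseudoResolvent T s v <• a :=
  (opPseudoResolventLin T s).map_smul _ _

theorem rightResolvent_add (s : ℍ) (v w : V) :
    rightResolvent T s (v + w) = rightResolvent T s v + rightResolvent T s w := by
  simp only [rightResolvent, map_add, smul_add]
  abel

/-- The factor `s̄` on the right lets only those scalars pass that commute with it. For `s` in `ℂ_i`
these include `ℂ_i`, so the map is linear on `V_i`. -/
theorem rightResolvent_right_smul {s a : ℍ} (h : a * star s = star s * a) (v : V) :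
    rightResolvent T s (v <• a) = rightResolvent T s v <• a := by
  simp only [rightResolvent, pseudoResolvent_right_smul, opPseudoResolvent_right_smul, smul_sub,
    right_smul_smul, h]

variable (V) in
/-- The right multiplication by a quaternion as a bounded operator. -/
def rightMul (a : ℍ) : V →L[ℝ] V :=
  LinearMap.mkContinuous
    { toFun := fun v : V => v <• a
      map_add' := fun _ _ => smul_add _ _ _
      map_smul' := fun _ _ => smul_comm _ _ _ } ‖a‖ fun v => (norm_right_smul v a).le

theorem continuous_rightResolvent (s : ℍ) : Continuous (rightResolvent T s) :=
  ((rightMul V (star s)).continuous.comp (pseudoResolvent T s).continuous).sub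
    (opPseudoResolvent T s).continuous

variable (T i) in
/-- The operator `v ↦ Q_s(T)⁻¹ v s̄ - T Q_s(T)⁻¹ v` on `V_i` for `s ∈ ℂ_i`. -/
def sliceResolvent (z : ℂ) : SliceSpace i V →L[ℂ] SliceSpace i V where
  toFun v := toSlice i (rightResolvent T (planeHom i z) ((toSlice i).symm v))
  map_add' v w := rightResolvent_add (V := V) _ _ _
  map_smul' w v := rightResolvent_right_smul (V := V) (a := planeHom i w) (by
    rw [← planeHom_conj, ← map_mul, mul_comm, map_mul]) _
  cont := continuous_rightResolvent (V := V) _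

theorem ofSliceOp_sliceResolvent (z : ℂ) (v : V) :
    ofSliceOp i (sliceResolvent T i z) v = rightResolvent T (planeHom i z) v := rfl

theorem right_smul_conj_add (z : ℂ) (v : V) :
    v <• planeHom i z + v <• star (planeHom i z) = (2 * z.re) • v := by
  rw [← planeHom_conj, ← add_smul, ← MulOpposite.op_add, ← map_add, Complex.add_conj,
    planeHom_ofReal, coe_real_smul_right]

theorem right_smul_conj_mul (z : ℂ) (v : V) :
    v <• star (planeHom i z) <• planeHom i z = ‖planeHom i z‖ ^ 2 • v := by
  rw [right_smul_smul, ← planeHom_conj, ← map_mul, mul_comm, Complex.mul_conj, planeHom_ofReal,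
    coe_real_smul_right, norm_planeHom, Complex.normSq_eq_norm_sq]

/-- `R_s(T; v)` belongs to the domain of `T` and `R_s(T; v) s - T R_s(T; v) = v`. -/
theorem rightResolvent_spec {z : ℂ} (hz : planeHom i z ∈ sResolventSet T) (v : V) :
    ∃ h : rightResolvent T (planeHom i z) v ∈ T.op.domain,
      rightResolvent T (planeHom i z) v <• planeHom i z -
        T.op ⟨rightResolvent T (planeHom i z) v, h⟩ = v := by
  set s := planeHom i z with hs
  have hQ := pseudoResolvent_mem T s v
  obtain ⟨hTQ, hv⟩ := pseudoResolvent_spec hz v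
  have hQs : pseudoResolvent T s v <• star s ∈ T.op.domain := T.op.domain.smul_mem _ hQ
  refine ⟨T.op.domain.sub_mem hQs hTQ, ?_⟩
  have h1 : T.op ⟨rightResolvent T s v, T.op.domain.sub_mem hQs hTQ⟩ =
      opPseudoResolvent T s v <• star s - T.op ⟨opPseudoResolvent T s v, hTQ⟩ := by
    have h2 := T.op.map_sub ⟨_, hQs⟩ ⟨_, hTQ⟩
    have h3 := T.op.map_smul (MulOpposite.op (star s)) ⟨_, hQ⟩
    exact h2.trans (congrArg (· - _) h3)
  have h4 := right_smul_conj_add (i := i) z (opPseudoResolvent T s v)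
  have h5 := right_smul_conj_mul (i := i) z (pseudoResolvent T s v)
  rw [← hs] at h4 h5
  -- With `x = Q_s(T)⁻¹ v` the left side is `x |s|² - (T x) s - (T x) s̄ + T² x`, and `s + s̄ = 2 Re
  -- s` turns it into `Q_s(T) x = v`.
  rw [h1, rightResolvent, smul_sub, h5]
  refine Eq.trans ?_ hv
  rw [show s.re = z.re from re_planeHom i z, ← h4]
  abel

/-- If `T u = u s`, then `Q_s(T) u = u (s² - 2 Re(s) s + |s|²) = 0`, and `Q_s(T)` is injective. -/
theorem eq_zero_of_right_smul_eq {z : ℂ} (hz : planeHom i z ∈ sResolventSet T) {u : V}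
    (hu : u ∈ T.op.domain) (h : u <• planeHom i z = T.op ⟨u, hu⟩) : u = 0 := by
  have hTu : T.op ⟨u, hu⟩ ∈ T.op.domain := h ▸ T.op.domain.smul_mem _ hu
  rw [← pseudoResolvent_quadOp hz hu hTu]
  have h2 : T.op ⟨T.op ⟨u, hu⟩, hTu⟩ = T.op ⟨u, hu⟩ <• planeHom i z := by
    rw [← T.op.map_smul]
    congr 1
    exact Subtype.ext h.symm
  have h4 := right_smul_conj_add (i := i) z (T.op ⟨u, hu⟩)
  have h5 := right_smul_conj_mul (i := i) z u
  rw [h2, re_planeHom, ← h4, ← h5, ← h, right_smul_smul u _ (star _), right_smul_smul u (star _),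
    ← planeHom_conj, ← map_mul, ← map_mul, mul_comm ((starRingEnd ℂ) z)]
  simp

/-- A right inverse of an injective operator is also a left inverse. -/
theorem rightResolvent_sub {z : ℂ} (hz : planeHom i z ∈ sResolventSet T) {u : V}
    (hu : u ∈ T.op.domain) :
    rightResolvent T (planeHom i z) (u <• planeHom i z - T.op ⟨u, hu⟩) = u := by
  obtain ⟨hd, hv⟩ := rightResolvent_spec hz (u <• planeHom i z - T.op ⟨u, hu⟩)
  refine sub_eq_zero.1 (eq_zero_of_right_smul_eq hz (T.op.domain.sub_mem hd hu) ?_)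
  refine Eq.trans ?_ (T.op.map_sub ⟨_, hd⟩ ⟨u, hu⟩).symm
  rw [smul_sub]
  exact sub_eq_sub_iff_sub_eq_sub.1 hv

theorem isBoundedInverse_sliceResolvent {z : ℂ} (hz : planeHom i z ∈ sResolventSet T) :
    IsBoundedInverse (z • opId ℂ (SliceSpace i V) - sliceOperator i T) (sliceResolvent T i z) :=
  isBoundedInverse_smul_sub_iff.2 ⟨fun v => rightResolvent_spec (V := V) hz v,
    fun u => rightResolvent_sub (V := V) hz u.2⟩

theorem complexResolvent_sliceOperator {z : ℂ} (hz : planeHom i z ∈ sResolventSet T) :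
    complexResolvent (sliceOperator i T) z = sliceResolvent T i z :=
  complexResolvent_eq (isBoundedInverse_sliceResolvent hz)

end SliceOperator

/-! ### Real and imaginary components of the weighted resolvents -/

section PlaneKernel

open MeasureTheory

variable {V : Type*} [NormedAddCommGroup V] [NormedSpace ℝ V] [CompleteSpace V]
  [Module ℍᵐᵒᵖ V] [IsScalarTower ℝ ℍᵐᵒᵖ V] [NormSMulClass ℍᵐᵒᵖ V] {T : ClosedRightOperator V}
  {i : ImagUnit}

theorem mem_sResolventSet_congr {s s' : ℍ} (hre : s.re = s'.re) (hn : ‖s‖ = ‖s'‖) :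
    s ∈ sResolventSet T ↔ s' ∈ sResolventSet T := by
  have h : quadOp T s = quadOp T s' := by rw [quadOp, quadOp, hre, hn]
  change (∃ B, _) ↔ ∃ B, _
  rw [h]

theorem conj_mem_slice_sResolventSet {z : ℂ} (hz : z ∈ slice i (sResolventSet T)) :
    (starRingEnd ℂ) z ∈ slice i (sResolventSet T) :=
  (mem_sResolventSet_congr (by simp [re_planeHom]) (by simp [norm_planeHom])).1 hz

theorem slice_sResolventSet_subset :
    slice i (sResolventSet T) ⊆ complexResolventSet (sliceOperator i T) :=
  fun _ hz => ⟨_, isBoundedInverse_sliceResolvent hz⟩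

theorem continuousOn_sliceResolvent :
    ContinuousOn (sliceResolvent T i) (slice i (sResolventSet T)) :=
  (differentiableOn_complexResolvent.continuousOn.mono slice_sResolventSet_subset).congr
    fun _ hz => (complexResolvent_sliceOperator hz).symm

/-- `R_s(T; v)` is `u s̄ - T u` for `u = Q_s(T)⁻¹ v`, and the resolvent at the conjugate point
recovers `u` from it. Continuity of `Q_s(T)⁻¹` in operator norm thus reduces to that of the complex
resolvent. -/
theorem pseudoResolventReal_eq {z : ℂ} (hz : z ∈ slice i (sResolventSet T)) :
    pseudoResolventReal T (planeHom i z) =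
      ofSliceOp i (sliceResolvent T i ((starRingEnd ℂ) z) * sliceResolvent T i z) := by
  ext v
  have h := rightResolvent_sub (conj_mem_slice_sResolventSet hz)
    (pseudoResolvent_mem T (planeHom i z) v)
  rw [planeHom_conj] at h
  refine h.symm.trans ?_
  change _ = rightResolvent T (planeHom i ((starRingEnd ℂ) z)) (rightResolvent T (planeHom i z) v)
  rw [planeHom_conj]
  rfl

theorem opPseudoResolvent_eq {z : ℂ} (hz : z ∈ slice i (sResolventSet T)) :
    opPseudoResolvent T (planeHom i z) = ofSliceOp i ((starRingEnd ℂ) z •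
      (sliceResolvent T i ((starRingEnd ℂ) z) * sliceResolvent T i z) - sliceResolvent T i z) := by
  ext v
  rw [map_sub]
  change _ = ofSliceOp i ((starRingEnd ℂ) z • _) v - ofSliceOp i (sliceResolvent T i z) v
  rw [ofSliceOp_smul, ← pseudoResolventReal_eq hz, ofSliceOp_sliceResolvent, rightResolvent,
    planeHom_conj]
  exact (sub_sub_cancel _ _).symm

theorem continuousOn_pseudoResolventReal :
    ContinuousOn (fun z => pseudoResolventReal T (planeHom i z)) (slice i (sResolventSet T)) := by
  refine ContinuousOn.congr ?_ fun z hz => pseudoResolventReal_eq hz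
  refine (ofSliceOp i).continuous.comp_continuousOn (ContinuousOn.mul ?_
    continuousOn_sliceResolvent)
  exact continuousOn_sliceResolvent.comp Complex.continuous_conj.continuousOn
    fun z hz => conj_mem_slice_sResolventSet hz

theorem continuousOn_opPseudoResolvent :
    ContinuousOn (fun z => opPseudoResolvent T (planeHom i z)) (slice i (sResolventSet T)) := by
  refine ContinuousOn.congr ?_ fun z hz => opPseudoResolvent_eq hz
  refine (ofSliceOp i).continuous.comp_continuousOn (ContinuousOn.sub (ContinuousOn.smul
    Complex.continuous_conj.continuousOn (ContinuousOn.mul ?_ continuousOn_sliceResolvent))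
    continuousOn_sliceResolvent)
  exact continuousOn_sliceResolvent.comp Complex.continuous_conj.continuousOn
    fun z hz => conj_mem_slice_sResolventSet hz

variable (T i) in
/-- The component `φ (w z̄) Q_s(T)⁻¹ - φ (w) T Q_s(T)⁻¹` of the weighted S-resolvent, where `φ` is
the real or the imaginary part. -/
def planeKernel (φ : ℂ →L[ℝ] ℝ) (z w : ℂ) : V →L[ℝ] V :=
  φ (w * (starRingEnd ℂ) z) • pseudoResolventReal T (planeHom i z) -
    φ w • opPseudoResolvent T (planeHom i z)

theorem pseudoResolventReal_congr {s s' : ℍ} (hre : s.re = s'.re) (hn : ‖s‖ = ‖s'‖) :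
    pseudoResolventReal T s = pseudoResolventReal T s' := by
  rw [pseudoResolventReal, pseudoResolvent_congr hre hn, ← pseudoResolventReal]

theorem planeKernel_congr (i j : ImagUnit) (φ : ℂ →L[ℝ] ℝ) (z w : ℂ) :
    planeKernel T i φ z w = planeKernel T j φ z w := by
  have h1 : (planeHom i z).re = (planeHom j z).re := by simp only [re_planeHom]
  have h2 : ‖planeHom i z‖ = ‖planeHom j z‖ := by simp only [norm_planeHom]
  rw [planeKernel, planeKernel, pseudoResolventReal_congr h1 h2, opPseudoResolvent_congr h1 h2]

/-- The operators at conjugate points coincide, so the conjugation falls on the coefficients alone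
and can be moved into `φ`. -/
theorem planeKernel_conj (φ : ℂ →L[ℝ] ℝ) (z w : ℂ) :
    planeKernel T i φ ((starRingEnd ℂ) z) ((starRingEnd ℂ) w) =
      planeKernel T i (φ.comp Complex.conjCLE.toContinuousLinearMap) z w := by
  have h1 : (planeHom i ((starRingEnd ℂ) z)).re = (planeHom i z).re := by simp [re_planeHom]
  have h2 : ‖planeHom i ((starRingEnd ℂ) z)‖ = ‖planeHom i z‖ := by simp [norm_planeHom]
  rw [planeKernel, planeKernel, pseudoResolventReal_congr h1 h2, opPseudoResolvent_congr h1 h2]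
  simp

/-- Together with `leftSResolvent_comp_mul` and `mul_comp_rightSResolvent` this is the core of the
comparison: the same two components occur each time, and only the action of `i` on the second one
changes. -/
theorem ofSliceOp_smul_sliceResolvent (z w : ℂ) :
    ofSliceOp i (w • sliceResolvent T i z) = planeKernel T i Complex.reCLM z w +
      rightMul V i.1 ∘L planeKernel T i Complex.imCLM z w := by
  ext v
  rw [ofSliceOp_smul, ofSliceOp_sliceResolvent, rightResolvent, smul_sub, right_smul_smul,
    ← planeHom_conj, ← map_mul, mul_comm, right_smul_planeHom, right_smul_planeHom]
  change _ = ((w * (starRingEnd ℂ) z).re • pseudoResolvent T (planeHom i z) v -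
    w.re • opPseudoResolvent T (planeHom i z) v) +
    ((w * (starRingEnd ℂ) z).im • pseudoResolvent T (planeHom i z) v -
    w.im • opPseudoResolvent T (planeHom i z) v) <• i.1
  rw [smul_sub, smul_comm (MulOpposite.op i.1), smul_comm (MulOpposite.op i.1)]
  abel

variable (L : LeftMultiplication V)

theorem LeftMultiplication.mul_coe (r : ℝ) (v : V) : L.mul (r : ℍ) v = r • v := by
  have h : L.mul (algebraMap ℝ ℍ r) = algebraMap ℝ (V →L[ℝ] V) r := L.mul.commutes r
  exact DFunLike.congr_fun h v

theorem LeftMultiplication.mul_planeHom (z : ℂ) (v : V) :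
    L.mul (planeHom i z) v = z.re • v + z.im • L.mul i.1 v := by
  rw [planeHom_apply, map_add, map_mul]
  change L.mul (z.re : ℍ) v + L.mul i.1 (L.mul (z.im : ℍ) v) = _
  rw [L.mul_coe, L.mul_coe, map_smul]

theorem leftSResolvent_comp_mul (z w : ℂ) :
    leftSResolvent L T (planeHom i z) ∘L L.mul (planeHom i w) =
      planeKernel T i Complex.reCLM z w + planeKernel T i Complex.imCLM z w ∘L L.mul i.1 := by
  ext v
  have h1 : L.mul (star (planeHom i z)) (L.mul (planeHom i w) v) =
      L.mul (planeHom i (w * (starRingEnd ℂ) z)) v := by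
    rw [mul_comm, map_mul, map_mul, planeHom_conj]
    rfl
  change pseudoResolventReal T (planeHom i z) (L.mul (star (planeHom i z)) (L.mul _ v)) -
    opPseudoResolvent T (planeHom i z) (L.mul (planeHom i w) v) =
    ((w * (starRingEnd ℂ) z).re • pseudoResolventReal T (planeHom i z) v -
    w.re • opPseudoResolvent T (planeHom i z) v) +
    ((w * (starRingEnd ℂ) z).im • pseudoResolventReal T (planeHom i z) (L.mul i.1 v) -
    w.im • opPseudoResolvent T (planeHom i z) (L.mul i.1 v))
  rw [h1, L.mul_planeHom, L.mul_planeHom, map_add, map_add, map_smul, map_smul, map_smul, map_smul]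
  abel

theorem mul_comp_rightSResolvent (z w : ℂ) :
    L.mul (planeHom i w) ∘L rightSResolvent L T (planeHom i z) =
      planeKernel T i Complex.reCLM z w + L.mul i.1 ∘L planeKernel T i Complex.imCLM z w := by
  ext v
  have h1 : ∀ u, L.mul (planeHom i w) (L.mul (star (planeHom i z)) u) =
      L.mul (planeHom i (w * (starRingEnd ℂ) z)) u := fun u => by
    rw [map_mul, map_mul, planeHom_conj]
    rfl
  change L.mul (planeHom i w) (-(opPseudoResolvent T (planeHom i z) v -
    L.mul (star (planeHom i z)) (pseudoResolventReal T (planeHom i z) v))) =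
    ((w * (starRingEnd ℂ) z).re • pseudoResolventReal T (planeHom i z) v -
    w.re • opPseudoResolvent T (planeHom i z) v) +
    L.mul i.1 ((w * (starRingEnd ℂ) z).im • pseudoResolventReal T (planeHom i z) v -
    w.im • opPseudoResolvent T (planeHom i z) v)
  rw [neg_sub, map_sub, h1, L.mul_planeHom, L.mul_planeHom, map_sub, map_smul, map_smul]
  abel

/-! ### Integrals along a curve -/

section Curve

variable {γ w : ℝ → ℂ}

theorem intervalIntegrable_planeKernel (hγ : ContinuousOn γ (Icc 0 1))
    (hγS : ∀ t ∈ Icc (0 : ℝ) 1, γ t ∈ slice i (sResolventSet T))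
    (hw : IntervalIntegrable w volume 0 1) (φ : ℂ →L[ℝ] ℝ) :
    IntervalIntegrable (fun t => planeKernel T i φ (γ t) (w t)) volume 0 1 := by
  rw [← uIcc_of_le (zero_le_one' ℝ)] at hγ hγS
  have hφ : ∀ {u : ℝ → ℂ}, IntervalIntegrable u volume 0 1 →
      IntervalIntegrable (fun t => φ (u t)) volume 0 1 := fun hu => by
    rw [intervalIntegrable_iff] at hu ⊢
    exact φ.integrable_comp hu
  have hconj : ContinuousOn (fun t => (starRingEnd ℂ) (γ t)) (uIcc 0 1) :=
    Complex.continuous_conj.comp_continuousOn hγ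
  exact ((hφ (hw.mul_continuousOn hconj)).smul_continuousOn
    (continuousOn_pseudoResolventReal.comp hγ hγS)).sub
    ((hφ hw).smul_continuousOn (continuousOn_opPseudoResolvent.comp hγ hγS))

theorem intervalIntegrable_smul_sliceResolvent (hγ : ContinuousOn γ (Icc 0 1))
    (hγS : ∀ t ∈ Icc (0 : ℝ) 1, γ t ∈ slice i (sResolventSet T))
    (hw : IntervalIntegrable w volume 0 1) :
    IntervalIntegrable (fun t => w t • sliceResolvent T i (γ t)) volume 0 1 :=
  hw.smul_continuousOn_Icc (continuousOn_sliceResolvent.comp hγ hγS)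

theorem ofSliceOp_integral (hγ : ContinuousOn γ (Icc 0 1))
    (hγS : ∀ t ∈ Icc (0 : ℝ) 1, γ t ∈ slice i (sResolventSet T))
    (hw : IntervalIntegrable w volume 0 1) :
    ofSliceOp i (∫ t in (0 : ℝ)..1, w t • sliceResolvent T i (γ t)) =
      (∫ t in (0 : ℝ)..1, planeKernel T i Complex.reCLM (γ t) (w t)) +
        rightMul V i.1 ∘L ∫ t in (0 : ℝ)..1, planeKernel T i Complex.imCLM (γ t) (w t) := by
  have hK := intervalIntegrable_planeKernel hγ hγS hw
  rw [← (ofSliceOp i).intervalIntegral_comp_comm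
    (intervalIntegrable_smul_sliceResolvent hγ hγS hw)]
  have h1 := (ContinuousLinearMap.compL ℝ V V V (rightMul V i.1)).intervalIntegral_comp_comm
    (hK Complex.imCLM)
  have h2 : IntervalIntegrable (fun t => ContinuousLinearMap.compL ℝ V V V (rightMul V i.1)
      (planeKernel T i Complex.imCLM (γ t) (w t))) volume 0 1 := by
    have := hK Complex.imCLM
    rw [intervalIntegrable_iff] at this ⊢
    exact ContinuousLinearMap.integrable_comp _ this
  simp only [ContinuousLinearMap.compL_apply] at h1 h2
  rw [← h1, ← intervalIntegral.integral_add (hK _) h2]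
  simp only [ofSliceOp_smul_sliceResolvent]

theorem integral_leftSResolvent (hγ : ContinuousOn γ (Icc 0 1))
    (hγS : ∀ t ∈ Icc (0 : ℝ) 1, γ t ∈ slice i (sResolventSet T))
    (hw : IntervalIntegrable w volume 0 1) :
    ∫ t in (0 : ℝ)..1, leftSResolvent L T (planeHom i (γ t)) ∘L L.mul (planeHom i (w t)) =
      (∫ t in (0 : ℝ)..1, planeKernel T i Complex.reCLM (γ t) (w t)) +
        (∫ t in (0 : ℝ)..1, planeKernel T i Complex.imCLM (γ t) (w t)) ∘L L.mul i.1 := by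
  have hK := intervalIntegrable_planeKernel hγ hγS hw
  have h1 := ((ContinuousLinearMap.compL ℝ V V V).flip (L.mul i.1)).intervalIntegral_comp_comm
    (hK Complex.imCLM)
  have h2 : IntervalIntegrable (fun t => (ContinuousLinearMap.compL ℝ V V V).flip (L.mul i.1)
      (planeKernel T i Complex.imCLM (γ t) (w t))) volume 0 1 := by
    have := hK Complex.imCLM
    rw [intervalIntegrable_iff] at this ⊢
    exact ContinuousLinearMap.integrable_comp _ this
  simp only [ContinuousLinearMap.flip_apply, ContinuousLinearMap.compL_apply] at h1 h2
  rw [← h1, ← intervalIntegral.integral_add (hK _) h2]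
  simp only [leftSResolvent_comp_mul]

theorem integral_rightSResolvent (hγ : ContinuousOn γ (Icc 0 1))
    (hγS : ∀ t ∈ Icc (0 : ℝ) 1, γ t ∈ slice i (sResolventSet T))
    (hw : IntervalIntegrable w volume 0 1) :
    ∫ t in (0 : ℝ)..1, L.mul (planeHom i (w t)) ∘L rightSResolvent L T (planeHom i (γ t)) =
      (∫ t in (0 : ℝ)..1, planeKernel T i Complex.reCLM (γ t) (w t)) +
        L.mul i.1 ∘L ∫ t in (0 : ℝ)..1, planeKernel T i Complex.imCLM (γ t) (w t) := by
  have hK := intervalIntegrable_planeKernel hγ hγS hw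
  have h1 := (ContinuousLinearMap.compL ℝ V V V (L.mul i.1)).intervalIntegral_comp_comm
    (hK Complex.imCLM)
  have h2 : IntervalIntegrable (fun t => ContinuousLinearMap.compL ℝ V V V (L.mul i.1)
      (planeKernel T i Complex.imCLM (γ t) (w t))) volume 0 1 := by
    have := hK Complex.imCLM
    rw [intervalIntegrable_iff] at this ⊢
    exact ContinuousLinearMap.integrable_comp _ this
  simp only [ContinuousLinearMap.compL_apply] at h1 h2
  rw [← h1, ← intervalIntegral.integral_add (hK _) h2]
  simp only [mul_comp_rightSResolvent]

end Curve

end PlaneKernel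

/-! ### Identification of the functional calculi -/

section Assembly

open MeasureTheory

variable {V : Type*} [NormedAddCommGroup V] [NormedSpace ℝ V] [CompleteSpace V]
  [Module ℍᵐᵒᵖ V] [IsScalarTower ℝ ℍᵐᵒᵖ V] [NormSMulClass ℍᵐᵒᵖ V] {T : ClosedRightOperator V}
  {i : ImagUnit} {f : ℍ → ℍ} {D U : Set ℍ} {c : ℍ}

theorem isBoundedOperator_sliceOperator (i : ImagUnit) (h : IsBoundedOperator T.op) :
    IsBoundedOperator (sliceOperator i T) := by
  obtain ⟨hd, C, hC⟩ := h
  refine ⟨eq_top_iff.2 fun v _ => ?_, C, fun u => hC ⟨_, u.2⟩⟩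
  have : (toSlice i).symm v ∈ T.op.domain := hd ▸ Submodule.mem_top
  exact this

namespace IsAdmissibleDomain

theorem compl_complexResolventSet_subset (hU : IsAdmissibleDomain T f D U c) (i : ImagUnit) :
    (complexResolventSet (sliceOperator i T))ᶜ ⊆ slice i U := fun _ hz =>
  hU.2.1 fun h => hz (slice_sResolventSet_subset h)

theorem closure_slice_subset (hU : IsAdmissibleDomain T f D U c) (i : ImagUnit) :
    closure (slice i U) ⊆ slice i D := fun _ hz => hU.2.2.1 (_root_.closure_slice_subset i U hz)

theorem isOpen_slice (hU : IsAdmissibleDomain T f D U c) (i : ImagUnit) : IsOpen (slice i U) :=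
  hU.1.isOpen.preimage (continuous_planeHom i)

/-- The boundary curves avoid the S-spectrum because it lies in the open set `U`; on them the
complex resolvent is given by `R_s(T; v)`. -/
theorem frontier_slice_subset (hU : IsAdmissibleDomain T f D U c) (i : ImagUnit) :
    frontier (slice i U) ⊆ slice i (sResolventSet T) := fun z hz => by
  by_contra h
  refine hz.2 ?_
  rw [(hU.isOpen_slice i).interior_eq]
  exact hU.2.1 h

theorem eq_coe_re (hU : IsAdmissibleDomain T f D U c)
    (hf : IsIntrinsicSliceHyperholomorphic f D) (i : ImagUnit) : c = (c.re : ℍ) := by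
  rcases hU.2.2.2 with ⟨-, h⟩ | ⟨-, -, rfl⟩
  · exact hf.value_at_infinity_real i h
  · simp

theorem value_at_infinity_slice (hU : IsAdmissibleDomain T f D U c)
    (hf : IsIntrinsicSliceHyperholomorphic f D) (i : ImagUnit) :
    (¬ Bornology.IsBounded (slice i U) ∧
        HasValueAtInfinity (sliceFunction i f) (slice i D) (c.re : ℂ)) ∨
      (IsBoundedOperator (sliceOperator i T) ∧ Bornology.IsBounded (slice i U) ∧
        (c.re : ℂ) = 0) := by
  rw [hU.1.axiallySymmetric.isBounded_slice_iff]
  rcases hU.2.2.2 with ⟨hb, h⟩ | ⟨hT, hb, rfl⟩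
  · refine Or.inl ⟨hb, ?_⟩
    have := IsIntrinsicSliceHyperholomorphic.hasValueAtInfinity_sliceFunction i h
    rwa [hf.value_at_infinity_real i h, ← planeHom_ofReal i, planeCoord_planeHom] at this
  · exact Or.inr ⟨isBoundedOperator_sliceOperator i hT, hb, by simp⟩

end IsAdmissibleDomain

variable (i f) in
/-- The weight `-i ρ f` that a curve `γ` in `ℂ_i` with the weight `ρ` carries in the Cauchy
integrals of the S-functional calculus. -/
def sliceWeight (γ ρ : ℝ → ℂ) (t : ℝ) : ℂ := -Complex.I * ρ t * sliceFunction i f (γ t)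

section Boundary

variable {ι : Type*} [Fintype ι] {γ ρ : ι → ℝ → ℂ}

theorem intervalIntegrable_sliceWeight (hf : IsIntrinsicSliceHyperholomorphic f D)
    (hU : IsAdmissibleDomain T f D U c) (h : IsWeightedBoundary γ ρ (slice i U)) (l : ι) :
    IntervalIntegrable (sliceWeight i f (γ l) (ρ l)) volume 0 1 := by
  refine ((h.intervalIntegrable l).const_mul _).mul_continuousOn ?_
  rw [uIcc_of_le zero_le_one]
  exact (hf.differentiableOn_sliceFunction i).continuousOn.comp (h.continuousOn l) fun t ht =>
    hU.closure_slice_subset i (h.mem_frontier l t ht).1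

theorem ofSliceOp_rieszDunford_integral (hf : IsIntrinsicSliceHyperholomorphic f D)
    (hU : IsAdmissibleDomain T f D U c) (h : IsWeightedBoundary γ ρ (slice i U)) :
    ofSliceOp i ((2 * Real.pi * Complex.I : ℂ)⁻¹ • ∑ l, ∫ t in (0 : ℝ)..1,
        (ρ l t * sliceFunction i f (γ l t)) • complexResolvent (sliceOperator i T) (γ l t)) =
      (2 * Real.pi)⁻¹ • ((∑ l, ∫ t in (0 : ℝ)..1, planeKernel T i Complex.reCLM (γ l t)
        (sliceWeight i f (γ l) (ρ l) t)) + rightMul V i.1 ∘L ∑ l, ∫ t in (0 : ℝ)..1,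
          planeKernel T i Complex.imCLM (γ l t) (sliceWeight i f (γ l) (ρ l) t)) := by
  have hS : ∀ l, ∀ t ∈ Icc (0 : ℝ) 1, γ l t ∈ slice i (sResolventSet T) := fun l t ht =>
    hU.frontier_slice_subset i (h.mem_frontier l t ht)
  have h1 : ∀ l, (-Complex.I) • ∫ t in (0 : ℝ)..1, (ρ l t * sliceFunction i f (γ l t)) •
      complexResolvent (sliceOperator i T) (γ l t) =
        ∫ t in (0 : ℝ)..1, sliceWeight i f (γ l) (ρ l) t • sliceResolvent T i (γ l t) := by
    intro l
    rw [← intervalIntegral.integral_smul]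
    refine intervalIntegral.integral_congr fun t ht => ?_
    rw [uIcc_of_le zero_le_one] at ht
    rw [complexResolvent_sliceOperator (hS l t ht), smul_smul, sliceWeight, mul_assoc]
  -- The factor `-i` split off here is the one contained in `ds_i`; it becomes part of
  -- `sliceWeight`.
  have h2 : (2 * Real.pi * Complex.I : ℂ)⁻¹ = ((2 * Real.pi)⁻¹ : ℝ) * (-Complex.I) := by
    rw [mul_inv, Complex.inv_I]
    push_cast
    rfl
  rw [h2, mul_smul, Finset.smul_sum, Complex.coe_smul, map_smul, map_sum]
  congr 1
  have h3 : ∀ l, ofSliceOp i ((-Complex.I) • ∫ t in (0 : ℝ)..1,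
      (ρ l t * sliceFunction i f (γ l t)) • complexResolvent (sliceOperator i T) (γ l t)) =
      _ := fun l => (congrArg (ofSliceOp i) (h1 l)).trans (ofSliceOp_integral (h.continuousOn l)
        (hS l) (intervalIntegrable_sliceWeight hf hU h l))
  rw [Finset.sum_congr rfl fun l _ => h3 l, Finset.sum_add_distrib]
  congr 1
  exact (map_sum (ContinuousLinearMap.compL ℝ V V V (rightMul V i.1)) _ _).symm

/-- The sign of the reflected weight `ρ` cancels the sign from conjugating `-i`. -/
theorem sliceWeight_conj (hf : IsIntrinsicSliceHyperholomorphic f D) {γ ρ : ℝ → ℂ} {t : ℝ}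
    (ht : γ t ∈ slice i D) :
    sliceWeight i f (fun t => (starRingEnd ℂ) (γ t)) (fun t => -(starRingEnd ℂ) (ρ t)) t =
      (starRingEnd ℂ) (sliceWeight i f γ ρ t) := by
  simp [sliceWeight, hf.sliceFunction_conj ht]

/-- The imaginary component of the Cauchy integral vanishes, because the boundary may be replaced by
its reflection at the real axis. -/
theorem sum_integral_planeKernel_im (hf : IsIntrinsicSliceHyperholomorphic f D)
    (hU : IsAdmissibleDomain T f D U c) (h : IsWeightedBoundary γ ρ (slice i U)) :
    ∑ l, ∫ t in (0 : ℝ)..1,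
      planeKernel T i Complex.imCLM (γ l t) (sliceWeight i f (γ l) (ρ l) t) = 0 := by
  have hconj := h.conj fun z hz => hU.1.axiallySymmetric.conj_mem_slice hz
  have hσ := hU.compl_complexResolventSet_subset i
  have hcl := hU.closure_slice_subset i
  have hD : IsOpen (slice i D) := hf.isOpen.preimage (continuous_planeHom i)
  have hval := hU.value_at_infinity_slice hf i
  -- The reflected curves bound the same domain and carry the same constant, so the two
  -- Riesz-Dunford integrals are equal.
  have hu := congrArg (ofSliceOp i) (add_left_cancel (rieszDunford_integral_unique h hconj hD
    (hf.differentiableOn_sliceFunction i) hσ hσ hcl hcl hval hval))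
  rw [ofSliceOp_rieszDunford_integral hf hU h, ofSliceOp_rieszDunford_integral hf hU hconj] at hu
  have hK : ∀ φ : ℂ →L[ℝ] ℝ, ∀ l, ∫ t in (0 : ℝ)..1,
      planeKernel T i φ ((starRingEnd ℂ) (γ l t)) (sliceWeight i f
        (fun t => (starRingEnd ℂ) (γ l t)) (fun t => -(starRingEnd ℂ) (ρ l t)) t) =
      ∫ t in (0 : ℝ)..1, planeKernel T i (φ.comp Complex.conjCLE.toContinuousLinearMap) (γ l t)
        (sliceWeight i f (γ l) (ρ l) t) := fun φ l => by
    refine intervalIntegral.integral_congr fun t ht => ?_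
    rw [uIcc_of_le zero_le_one] at ht
    rw [sliceWeight_conj hf (hcl (h.mem_frontier l t ht).1), planeKernel_conj]
  have hre : Complex.reCLM.comp Complex.conjCLE.toContinuousLinearMap = Complex.reCLM := by
    ext; simp
  have him : Complex.imCLM.comp Complex.conjCLE.toContinuousLinearMap = -Complex.imCLM := by
    ext; simp
  have hneg : ∀ z w, planeKernel T i (-Complex.imCLM) z w = -planeKernel T i Complex.imCLM z w := by
    intro z w
    simp only [planeKernel, neg_apply, neg_smul]
    abel
  simp only [hK, hre, him, hneg, intervalIntegral.integral_neg, Finset.sum_neg_distrib] at hu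
  -- The real components agree and the imaginary ones are opposite, which leaves `N v i = -(N v i)`
  -- for the sum `N` of the imaginary parts.
  have hu2 := add_left_cancel (smul_right_injective _ (inv_ne_zero
    (mul_ne_zero two_ne_zero Real.pi_ne_zero)) hu)
  ext v
  set N := ∑ l, ∫ t in (0 : ℝ)..1,
    planeKernel T i Complex.imCLM (γ l t) (sliceWeight i f (γ l) (ρ l) t)
  have hv : N v <• i.1 = (-N v) <• i.1 := DFunLike.congr_fun hu2 v
  rw [smul_neg, eq_neg_iff_add_eq_zero, ← two_smul ℝ, smul_eq_zero] at hv
  replace hv := hv.resolve_left two_ne_zero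
  -- Right multiplication by `i` preserves the norm, so `N v i = 0` forces `N v = 0`.
  have hn := norm_right_smul (N v) i.1
  rw [hv, i.2.2, one_mul, norm_zero] at hn
  exact norm_eq_zero.1 hn.symm

end Boundary

section Calculus

variable {n : ℕ} {γ : Fin n → ℝ → ℂ}

variable (T f c i) in
/-- The operator of the Riesz-Dunford functional calculus on `V_i` for the boundary `γ`. -/
def rieszDunfordOp {n : ℕ} (γ : Fin n → ℝ → ℂ) : SliceSpace i V →L[ℂ] SliceSpace i V :=
  (c.re : ℂ) • ContinuousLinearMap.id ℂ (SliceSpace i V) + (2 * Real.pi * Complex.I : ℂ)⁻¹ •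
    curvesIntegral γ (fun z dz => (sliceFunction i f z * dz) •
      complexResolvent (sliceOperator i T) z)

variable (T f c i) in
/-- The value of the S-functional calculus in terms of `Q_s(T)⁻¹`, `T Q_s(T)⁻¹` and real scalars. -/
def sCauchyOp {n : ℕ} (γ : Fin n → ℝ → ℂ) : V →L[ℝ] V :=
  c.re • ContinuousLinearMap.id ℝ V + (2 * Real.pi)⁻¹ • ∑ l, ∫ t in (0 : ℝ)..1,
    planeKernel T i Complex.reCLM (γ l t) (sliceWeight i f (γ l) (deriv (γ l)) t)

theorem ofSliceOp_rieszDunfordOp (hf : IsIntrinsicSliceHyperholomorphic f D)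
    (hU : IsAdmissibleDomain T f D U c) (hγ : IsPositiveBoundary γ (slice i U)) :
    ofSliceOp i (rieszDunfordOp T i f c γ) = sCauchyOp T i f c γ := by
  have h := hγ.isWeightedBoundary (hU.isOpen_slice i)
  have h1 := ofSliceOp_rieszDunford_integral hf hU h
  rw [sum_integral_planeKernel_im hf hU h, ContinuousLinearMap.comp_zero, add_zero] at h1
  rw [rieszDunfordOp, sCauchyOp, map_add, ← h1]
  congr 1
  · rw [Complex.coe_smul, map_smul]
    rfl
  · simp only [curvesIntegral, mul_comm]

theorem isRieszDunford_rieszDunfordOp (hf : IsIntrinsicSliceHyperholomorphic f D)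
    (hU : IsAdmissibleDomain T f D U c) (hγ : IsPositiveBoundary γ (slice i U)) :
    IsRieszDunford (sliceOperator i T) (sliceFunction i f) (slice i D)
      (rieszDunfordOp T i f c γ) :=
  ⟨hf.isOpen.preimage (continuous_planeHom i), hf.differentiableOn_sliceFunction i,
    slice i U, c.re, n, γ, hU.1.slices i, hU.compl_complexResolventSet_subset i,
    hU.closure_slice_subset i, hU.value_at_infinity_slice hf i, hγ, rfl⟩

/-- Neither the kernel, which depends on `Re s` and `|s|`, nor the complex coordinate of `f`
distinguishes between planes. -/
theorem sCauchyOp_congr (hf : IsIntrinsicSliceHyperholomorphic f D)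
    (hU : IsAdmissibleDomain T f D U c) (hγ : IsPositiveBoundary γ (slice i U)) (j : ImagUnit) :
    sCauchyOp T i f c γ = sCauchyOp T j f c γ := by
  have h := hγ.isWeightedBoundary (hU.isOpen_slice i)
  rw [sCauchyOp, sCauchyOp]
  congr 2
  refine Finset.sum_congr rfl fun l _ => intervalIntegral.integral_congr fun t ht => ?_
  rw [uIcc_of_le zero_le_one] at ht
  simp only [sliceWeight]
  rw [planeKernel_congr i j, hf.sliceFunction_congr i j
    (hU.closure_slice_subset i (h.mem_frontier l t ht).1)]

theorem LeftMultiplication.mul_value_at_infinity (L : LeftMultiplication V) (hf : IsIntrinsicSliceHyperholomorphic f D)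
    (hU : IsAdmissibleDomain T f D U c) (i : ImagUnit) :
    L.mul c = c.re • ContinuousLinearMap.id ℝ V := by
  ext v
  rw [hU.eq_coe_re hf i, L.mul_coe]
  simp

theorem leftSCauchyIntegral_eq (L : LeftMultiplication V)
    (hf : IsIntrinsicSliceHyperholomorphic f D) (hU : IsAdmissibleDomain T f D U c)
    (hγ : IsPositiveBoundary γ (slice i U)) :
    leftSCauchyIntegral L T f c i γ = sCauchyOp T i f c γ := by
  have h := hγ.isWeightedBoundary (hU.isOpen_slice i)
  rw [leftSCauchyIntegral, sCauchyOp, L.mul_value_at_infinity hf hU i]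
  congr 2
  have h1 : ∀ l, ∫ t in (0 : ℝ)..1, leftSResolvent L T (planeHom i (γ l t)) ∘L
      L.mul (-i.1 * planeHom i (deriv (γ l) t) * f (planeHom i (γ l t))) = _ := fun l =>
    (intervalIntegral.integral_congr fun t ht => by
      rw [uIcc_of_le zero_le_one] at ht
      rw [← hf.planeHom_sliceFunction (hU.closure_slice_subset i (h.mem_frontier l t ht).1),
        ← planeHom_I i, ← map_neg, ← map_mul, ← map_mul]
      rfl).trans (integral_leftSResolvent L (h.continuousOn l)
        (fun t ht => hU.frontier_slice_subset i (h.mem_frontier l t ht))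
        (intervalIntegrable_sliceWeight hf hU h l))
  have h2 := map_sum ((ContinuousLinearMap.compL ℝ V V V).flip (L.mul i.1)) (fun l =>
    ∫ t in (0 : ℝ)..1, planeKernel T i Complex.imCLM (γ l t)
      (sliceWeight i f (γ l) (deriv (γ l)) t)) Finset.univ
  rw [sum_integral_planeKernel_im hf hU h, map_zero] at h2
  simp only [ContinuousLinearMap.flip_apply, ContinuousLinearMap.compL_apply] at h2
  rw [curvesIntegral, Finset.sum_congr rfl fun l _ => h1 l, Finset.sum_add_distrib, ← h2, add_zero]

theorem rightSCauchyIntegral_eq (L : LeftMultiplication V)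
    (hf : IsIntrinsicSliceHyperholomorphic f D) (hU : IsAdmissibleDomain T f D U c)
    (hγ : IsPositiveBoundary γ (slice i U)) :
    rightSCauchyIntegral L T f c i γ = sCauchyOp T i f c γ := by
  have h := hγ.isWeightedBoundary (hU.isOpen_slice i)
  rw [rightSCauchyIntegral, sCauchyOp, L.mul_value_at_infinity hf hU i]
  congr 2
  have h1 : ∀ l, ∫ t in (0 : ℝ)..1, L.mul (f (planeHom i (γ l t)) *
      (-i.1 * planeHom i (deriv (γ l) t))) ∘L rightSResolvent L T (planeHom i (γ l t)) = _ :=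
    fun l => (intervalIntegral.integral_congr fun t ht => by
      rw [uIcc_of_le zero_le_one] at ht
      -- An intrinsic `f` maps the plane into itself, so `f(s)` and `ds_i` commute and the weight is
      -- the one of the left version.
      rw [← hf.planeHom_sliceFunction (hU.closure_slice_subset i (h.mem_frontier l t ht).1),
        ← planeHom_I i, ← map_neg, ← map_mul, ← map_mul, mul_comm]
      rfl).trans (integral_rightSResolvent L (h.continuousOn l)
        (fun t ht => hU.frontier_slice_subset i (h.mem_frontier l t ht))
        (intervalIntegrable_sliceWeight hf hU h l))
  have h2 := map_sum (ContinuousLinearMap.compL ℝ V V V (L.mul i.1)) (fun l =>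
    ∫ t in (0 : ℝ)..1, planeKernel T i Complex.imCLM (γ l t)
      (sliceWeight i f (γ l) (deriv (γ l)) t)) Finset.univ
  rw [sum_integral_planeKernel_im hf hU h, map_zero] at h2
  simp only [ContinuousLinearMap.compL_apply] at h2
  rw [curvesIntegral, Finset.sum_congr rfl fun l _ => h1 l, Finset.sum_add_distrib, ← h2, add_zero]

/-- The unit used to compute `A` need not be `i`: the slices of `U` in all planes have the same
coordinates, so the same curves serve in `ℂ_i`. -/
theorem IsSFunctionalCalculus.exists_isRieszDunford {L : LeftMultiplication V} {A : V →L[ℝ] V}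
    (hA : IsSFunctionalCalculus L T f D A) (hf : IsIntrinsicSliceHyperholomorphic f D)
    (i : ImagUnit) : ∃ B : SliceSpace i V →L[ℂ] SliceSpace i V,
      IsRieszDunford (sliceOperator i T) (sliceFunction i f) (slice i D) B ∧
        ofSliceOp i B = A := by
  obtain ⟨j, U, c, n, γ, hU, hγ, hA⟩ := hA
  have hγ' : IsPositiveBoundary γ (slice i U) := by
    rwa [hU.1.axiallySymmetric.slice_eq i j]
  refine ⟨_, isRieszDunford_rieszDunfordOp hf hU hγ', ?_⟩
  rw [ofSliceOp_rieszDunfordOp hf hU hγ', sCauchyOp_congr hf hU hγ' j]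
  rcases hA with rfl | rfl
  · exact (leftSCauchyIntegral_eq L hf hU hγ).symm
  · exact (rightSCauchyIntegral_eq L hf hU hγ).symm

theorem IsRieszDunford.unique {E : Type*} [NormedAddCommGroup E] [NormedSpace ℂ E]
    [CompleteSpace E] {A : E →ₗ.[ℂ] E} {g : ℂ → ℂ} {D : Set ℂ} {B B' : E →L[ℂ] E}
    (h : IsRieszDunford A g D B) (h' : IsRieszDunford A g D B') : B = B' := by
  obtain ⟨hD, hg, W, c, n, γ, hW, hσ, hWD, hc, hγ, rfl⟩ := h
  obtain ⟨-, -, W', c', n', γ', hW', hσ', hWD', hc', hγ', rfl⟩ := h'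
  have := rieszDunford_integral_unique (hγ.isWeightedBoundary hW.isOpen)
    (hγ'.isWeightedBoundary hW'.isOpen) hD hg hσ hσ' hWD hWD' hc hc'
  simp only [mul_comm _ (g _)] at this
  exact this

theorem curvesIntegral_rightResolvent (hf : IsIntrinsicSliceHyperholomorphic f D)
    (hU : IsAdmissibleDomain T f D U c) (hγ : IsPositiveBoundary γ (slice i U)) (v : V) :
    CurvesIntegrable γ (fun z dz =>
      rightResolvent T (planeHom i z) v <• f (planeHom i z) <• planeHom i dz) ∧
    ofSliceOp i (rieszDunfordOp T i f c γ) v = v <• c + curvesIntegral γ (fun z dz =>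
      rightResolvent T (planeHom i z) v <• f (planeHom i z) <• planeHom i dz)
        <• (((2 * Real.pi)⁻¹ : ℝ) • (-i.1)) := by
  have h := hγ.isWeightedBoundary (hU.isOpen_slice i)
  have hS : ∀ l, ∀ t ∈ Icc (0 : ℝ) 1, γ l t ∈ slice i (sResolventSet T) := fun l t ht =>
    hU.frontier_slice_subset i (h.mem_frontier l t ht)
  -- Evaluation at `v` is bounded and real linear, so it commutes with the integral and carries
  -- integrability over from the operators to the vectors.
  let ev : (SliceSpace i V →L[ℂ] SliceSpace i V) →L[ℝ] V :=
    (ContinuousLinearMap.apply ℝ V v).comp (ofSliceOp i)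
  have hev : ∀ l, ∀ t ∈ uIcc (0 : ℝ) 1,
      ev ((sliceFunction i f (γ l t) * deriv (γ l) t) •
        complexResolvent (sliceOperator i T) (γ l t)) =
      rightResolvent T (planeHom i (γ l t)) v <• f (planeHom i (γ l t)) <•
        planeHom i (deriv (γ l) t) := fun l t ht => by
    rw [uIcc_of_le zero_le_one] at ht
    rw [complexResolvent_sliceOperator (hS l t ht), right_smul_smul,
      ← hf.planeHom_sliceFunction (hU.closure_slice_subset i (h.mem_frontier l t ht).1), ← map_mul]
    rfl
  have hint : ∀ l, IntervalIntegrable (fun t => (sliceFunction i f (γ l t) * deriv (γ l) t) •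
      complexResolvent (sliceOperator i T) (γ l t)) volume 0 1 := fun l => by
    have hg : ContinuousOn (fun t => sliceFunction i f (γ l t)) (uIcc 0 1) := by
      rw [uIcc_of_le zero_le_one]
      exact (hf.differentiableOn_sliceFunction i).continuousOn.comp (h.continuousOn l) fun t ht =>
        hU.closure_slice_subset i (h.mem_frontier l t ht).1
    refine ((h.intervalIntegrable l).continuousOn_mul hg).smul_continuousOn_Icc ?_
    exact differentiableOn_complexResolvent.continuousOn.comp (h.continuousOn l)
      fun t ht => slice_sResolventSet_subset (hS l t ht)
  constructor
  · intro l
    have h1 : IntervalIntegrable (fun t => ev ((sliceFunction i f (γ l t) * deriv (γ l) t) •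
        complexResolvent (sliceOperator i T) (γ l t))) volume 0 1 := by
      have := hint l
      rw [intervalIntegrable_iff] at this ⊢
      exact ev.integrable_comp this
    exact h1.congr fun t ht => hev l t (uIoc_subset_uIcc ht)
  · have h1 : curvesIntegral γ (fun z dz =>
        rightResolvent T (planeHom i z) v <• f (planeHom i z) <• planeHom i dz) =
        ev (curvesIntegral γ (fun z dz => (sliceFunction i f z * dz) •
          complexResolvent (sliceOperator i T) z)) := by
      simp only [curvesIntegral]
      rw [map_sum]
      refine Finset.sum_congr rfl fun l _ => ?_
      rw [← ev.intervalIntegral_comp_comm (hint l)]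
      exact (intervalIntegral.integral_congr (hev l)).symm
    have h2 : ((2 * Real.pi)⁻¹ : ℝ) • (-i.1) = planeHom i (2 * Real.pi * Complex.I)⁻¹ := by
      rw [mul_inv _ Complex.I, Complex.inv_I, ← planeHom_I i, ← map_neg, ← map_smul,
        Complex.real_smul]
      push_cast
      rfl
    have h3 : v <• c = v <• planeHom i (c.re : ℂ) := by
      rw [planeHom_ofReal, ← hU.eq_coe_re hf i]
    rw [h1, h2, h3]
    rfl

end Calculus

end Assembly

end

theorem mainTheorem8 {V : Type*} [NormedAddCommGroup V] [NormedSpace ℝ V] [CompleteSpace V]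
    [Module ℍᵐᵒᵖ V] [IsScalarTower ℝ ℍᵐᵒᵖ V] [NormSMulClass ℍᵐᵒᵖ V]
    (T : ClosedRightOperator V) (hT : (sResolventSet T).Nonempty)
    (f : ℍ → ℍ) (D : Set ℍ) (hf : IsAdmissibleFunction T f D) :
    -- the integral representation of `f(T)`, for every imaginary unit and every domain
    (∀ (L : LeftMultiplication V) (A : V →L[ℝ] V), IsSFunctionalCalculus L T f D A →
      ∀ (i : ImagUnit) (U : Set ℍ) (c : ℍ) (n : ℕ) (γ : Fin n → ℝ → ℂ),
        IsAdmissibleDomain T f D U c → IsPositiveBoundary γ (slice i U) → ∀ v : V,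
          CurvesIntegrable γ (fun z dz =>
            rightResolvent T (planeHom i z) v <• f (planeHom i z) <• planeHom i dz) ∧
          A v = v <• c + curvesIntegral γ (fun z dz =>
            rightResolvent T (planeHom i z) v <• f (planeHom i z) <• planeHom i dz)
              <• (((2 * Real.pi)⁻¹ : ℝ) • (-i.1))) ∧
    -- the independence of the left multiplication
    (∀ (L₁ L₂ : LeftMultiplication V) (A₁ A₂ : V →L[ℝ] V),
      IsSFunctionalCalculus L₁ T f D A₁ → IsSFunctionalCalculus L₂ T f D A₂ →
        ∀ v : V, A₁ v = A₂ v) ∧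
    -- the compatibility with the Riesz-Dunford functional calculus on `V_i`
    (∀ (L : LeftMultiplication V) (A : V →L[ℝ] V), IsSFunctionalCalculus L T f D A →
      ∀ i : ImagUnit,
        (∃ B : SliceSpace i V →L[ℂ] SliceSpace i V,
          IsRieszDunford (sliceOperator i T) (sliceFunction i f) (slice i D) B) ∧
        ∀ B : SliceSpace i V →L[ℂ] SliceSpace i V,
          IsRieszDunford (sliceOperator i T) (sliceFunction i f) (slice i D) B →
            ∀ v : V, B (toSlice i v) = toSlice i (A v)) := by
  refine ⟨fun L A hA i U c n γ hU hγ v => ?_, fun L₁ L₂ A₁ A₂ h₁ h₂ v => ?_,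
    fun L A hA i => ?_⟩
  · obtain ⟨B, hB, rfl⟩ := hA.exists_isRieszDunford hf.1 i
    rw [hB.unique (isRieszDunford_rieszDunfordOp hf.1 hU hγ)]
    exact curvesIntegral_rightResolvent hf.1 hU hγ v
  -- Any plane will do: both operators are the Riesz-Dunford operator on `V_i`, which knows no left
  -- multiplication.
  · have i : ImagUnit := h₁.choose
    obtain ⟨B₁, hB₁, rfl⟩ := h₁.exists_isRieszDunford hf.1 i
    obtain ⟨B₂, hB₂, rfl⟩ := h₂.exists_isRieszDunford hf.1 i
    rw [hB₁.unique hB₂]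
  · obtain ⟨B, hB, rfl⟩ := hA.exists_isRieszDunford hf.1 i
    refine ⟨⟨B, hB⟩, fun B' hB' v => ?_⟩
    rw [hB'.unique hB]
    exact (toSlice_ofSliceOp i B v).symm
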